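/- Let $K$ be a field and let $A=\bigoplus_{i\ge 0}A_i$ be a finitely generated graded commutative $K$-algebra (for instance the coordinate algebra $\bigoplus_{i\ge 0}H^0(X,\mathcal O_X(i))$ of a projective scheme $X$ over $K$ with a very ample sheaf $\mathcal O_X(1)$). For a field extension $\kappa$ of $K$ and $\mathbb Z$-graded $A\otimes_K\kappa$-modules $M,N$, let $\operatorname{Ext}^{i,0}_{A\otimes\kappa}(M,N)$ denote the Ext groups in the abelian category of graded modules and homomorphisms of degree $0$. For $q\in\mathbb Z$ let $M_{\le q}=M/M_{\ge q+1}$, where $M_{\ge q+1}$ is the submodule of the elements of degree at least $q+1$; the functor $M\mapsto M_{\le q}$ is exact, and so induces canonical maps $\operatorname{Ext}^{i,0}_{A\otimes\kappa}(M,N)\to\operatorname{Ext}^{i,0}_{A\otimes\kappa}(M_{\le q},N_{\le q})$. Fix an integer $i\ge 0$. (1) For any finitely generated graded $A$-modules $M,N$ there is an integer $q_0$ such that for all $q\ge q_0$ the canonical map $$\operatorname{Ext}^{i,0}_A(M,N)\longrightarrow \operatorname{Ext}^{i,0}_A(M_{\le q},N_{\le q})$$ is an isomorphism. (2) Let $S$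 be a projective scheme over $K$ and let $\mathcal M,\mathcal N$ be families of finitely generated graded $A$-modules parametrized by $S$, that is, graded $A\otimes_K\mathcal O_S$-modules that are locally generated over $A\otimes_K\mathcal O_S$ by finitely many homogeneous sections and whose graded components are locally free $\mathcal O_S$-modules of finite rank. Then there is an integer $q_0$ such that for all $q\ge q_0$ and all points $s\in S$, with residue field $\kappa(s)$ and fibres $M_s=\mathcal M\otimes_{\mathcal O_S}\kappa(s)$ and $N_s=\mathcal N\otimes_{\mathcal O_S}\kappa(s)$, the canonical map $$\operatorname{Ext}^{i,0}_{A\otimes\kappa(s)}(M_s,N_s)\longrightarrow \operatorname{Ext}^{i,0}_{A\otimes\kappa(s)}\big((M_s)_{\le q},(N_s)_{\le q}\big)$$ is an isomorphism. -/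

import Mathlib

open CategoryTheory CategoryTheory.Limits AlgebraicGeometry TensorProduct

universe u

/-- A `ℤ`-graded module over the graded `R`-algebra `R ⊗_K A`, where `A = ⨁ 𝓐 i` is an `ℕ`-graded
commutative `K`-algebra and `R` is a commutative `K`-algebra through `φ : K → R`: a family of
`R`-modules `X j` together with `R`-linear actions `𝓐 i × X j → X (i + j)`.
For `R = K` and `φ = id` this is a `ℤ`-graded `A`-module `⨁ X j`. -/
structure GrMod {K A R : Type u} [Field K] [CommRing A] [Algebra K A] [CommRing R]
    (𝓐 : ℕ → Submodule K A) [GradedAlgebra 𝓐] (φ : K →+* R) where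
  /-- the component of degree `j` -/
  X : ℤ → Type u
  [addCommGroup : ∀ j, AddCommGroup (X j)]
  [module : ∀ j, Module R (X j)]
  /-- the action of the elements of degree `i` of `A` -/
  act : ∀ (i : ℕ) {j k : ℤ}, (i : ℤ) + j = k → 𝓐 i →+ (X j →ₗ[R] X k)
  act_smul : ∀ (i : ℕ) {j k : ℤ} (h : (i : ℤ) + j = k) (c : K) (a : 𝓐 i) (x : X j),
    act i h (c • a) x = φ c • act i h a x
  act_one : ∀ {j : ℤ} (h : ((0 : ℕ) : ℤ) + j = j) (x : X j),
    act 0 h ⟨1, SetLike.GradedOne.one_mem⟩ x = x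
  act_mul : ∀ (i i' : ℕ) {j k l : ℤ} (h : (i' : ℤ) + j = k) (h' : (i : ℤ) + k = l)
    (h'' : ((i + i' : ℕ) : ℤ) + j = l) (a : 𝓐 i) (b : 𝓐 i') (x : X j),
    act (i + i') h'' ⟨a.1 * b.1, SetLike.GradedMul.mul_mem a.2 b.2⟩ x = act i h' a (act i' h b x)

namespace GrMod

variable {K A R : Type u} [Field K] [CommRing A] [Algebra K A] [CommRing R]
  {𝓐 : ℕ → Submodule K A} [GradedAlgebra 𝓐] {φ : K →+* R}

instance (M : GrMod 𝓐 φ) (j : ℤ) : AddCommGroup (M.X j) := M.addCommGroup j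
instance (M : GrMod 𝓐 φ) (j : ℤ) : Module R (M.X j) := M.module j

/-- A homomorphism of degree `0`. -/
@[ext]
structure Hom (M N : GrMod 𝓐 φ) where
  app : ∀ j, M.X j →ₗ[R] N.X j
  comm : ∀ (i : ℕ) {j k : ℤ} (h : (i : ℤ) + j = k) (a : 𝓐 i) (x : M.X j),
    app k (M.act i h a x) = N.act i h a (app j x)

/-- Graded modules and homomorphisms of degree `0`. -/
instance : Category (GrMod 𝓐 φ) where
  Hom := Hom
  id M := ⟨fun _ => LinearMap.id, fun _ _ _ _ _ _ => rfl⟩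
  comp f g := ⟨fun j => g.app j ∘ₗ f.app j, fun i _ _ h a x => by
    simp [f.comm, g.comm]⟩

variable {M N P : GrMod 𝓐 φ}

theorem hom_ext {f g : M ⟶ N} (h : ∀ j x, f.app j x = g.app j x) : f = g :=
  Hom.ext (funext fun j => LinearMap.ext (h j))

@[simp] theorem id_app (j : ℤ) : (𝟙 M : M ⟶ M).app j = LinearMap.id := rfl
@[simp] theorem comp_app (f : M ⟶ N) (g : N ⟶ P) (j : ℤ) :
    (f ≫ g).app j = g.app j ∘ₗ f.app j := rfl
theorem comp_app_apply (f : M ⟶ N) (g : N ⟶ P) (j : ℤ) (x : M.X j) :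
    (f ≫ g).app j x = g.app j (f.app j x) := rfl

instance : Zero (M ⟶ N) := ⟨⟨fun _ => 0, fun _ _ _ _ _ _ => by simp⟩⟩
instance : Add (M ⟶ N) := ⟨fun f g => ⟨fun j => f.app j + g.app j, fun _ _ _ _ _ _ => by
  simp [f.comm, g.comm]⟩⟩
instance : Neg (M ⟶ N) := ⟨fun f => ⟨fun j => -f.app j, fun _ _ _ _ _ _ => by simp [f.comm]⟩⟩
instance : Sub (M ⟶ N) := ⟨fun f g => ⟨fun j => f.app j - g.app j, fun _ _ _ _ _ _ => by
  simp [f.comm, g.comm]⟩⟩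
instance : SMul R (M ⟶ N) := ⟨fun r f => ⟨fun j => r • f.app j, fun _ _ _ _ _ _ => by
  simp [f.comm]⟩⟩
instance instSMulNat : SMul ℕ (M ⟶ N) := ⟨fun r f => ⟨fun j => r • f.app j, fun _ _ _ _ _ _ => by
  simp [f.comm]⟩⟩
instance instSMulInt : SMul ℤ (M ⟶ N) := ⟨fun r f => ⟨fun j => r • f.app j, fun _ _ _ _ _ _ => by
  simp [f.comm]⟩⟩

theorem app_injective :
    Function.Injective (fun (f : M ⟶ N) => (fun j => f.app j : ∀ j, M.X j →ₗ[R] N.X j)) :=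
  fun _ _ h => Hom.ext h

instance : AddCommGroup (M ⟶ N) :=
  app_injective.addCommGroup _ rfl (fun _ _ => rfl) (fun _ => rfl) (fun _ _ => rfl)
    (fun _ _ => rfl) (fun _ _ => rfl)

@[simp] theorem zero_app (j : ℤ) : (0 : M ⟶ N).app j = 0 := rfl
@[simp] theorem add_app (f g : M ⟶ N) (j : ℤ) : (f + g).app j = f.app j + g.app j := rfl
@[simp] theorem smul_app (r : R) (f : M ⟶ N) (j : ℤ) : (r • f).app j = r • f.app j := rfl

instance : Module R (M ⟶ N) where
  one_smul _ := hom_ext fun _ _ => by simp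
  mul_smul _ _ _ := hom_ext fun _ _ => by simp [mul_smul]
  smul_zero _ := hom_ext fun _ _ => by simp
  smul_add _ _ _ := hom_ext fun _ _ => by simp
  add_smul _ _ _ := hom_ext fun _ _ => by simp [add_smul]
  zero_smul _ := hom_ext fun _ _ => by simp

instance : Preadditive (GrMod 𝓐 φ) where
  add_comp _ _ _ _ _ _ := hom_ext fun _ _ => by simp
  comp_add _ _ _ _ _ _ := hom_ext fun _ _ => by simp

instance : Linear R (GrMod 𝓐 φ) where
  smul_comp _ _ _ _ _ _ := hom_ext fun _ _ => by simp
  comp_smul _ _ _ _ _ _ := hom_ext fun _ _ => by simp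

/-- A graded submodule. -/
structure Sub (M : GrMod 𝓐 φ) where
  N : ∀ j, Submodule R (M.X j)
  act_mem : ∀ (i : ℕ) {j k : ℤ} (h : (i : ℤ) + j = k) (a : 𝓐 i) (x : M.X j),
    x ∈ N j → M.act i h a x ∈ N k

/-- A graded submodule as a graded module. -/
def Sub.toGrMod (S : Sub M) : GrMod 𝓐 φ where
  X j := S.N j
  act i _ _ h :=
    { toFun := fun a => (M.act i h a).restrict (fun x hx => S.act_mem i h a x hx)
      map_zero' := by ext; simp
      map_add' := fun _ _ => by ext; simp }
  act_smul i _ _ h c a x := Subtype.ext (M.act_smul i h c a x.1)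
  act_one h x := Subtype.ext (M.act_one h x.1)
  act_mul i i' _ _ _ h h' h'' a b x := Subtype.ext (M.act_mul i i' h h' h'' a b x.1)

/-- The inclusion of a graded submodule. -/
def Sub.incl (S : Sub M) : S.toGrMod ⟶ M :=
  Hom.mk (fun j => (S.N j).subtype) (fun _ _ _ _ _ _ => rfl)

/-- The quotient of a graded module by a graded submodule. -/
def Sub.quot (S : Sub M) : GrMod 𝓐 φ where
  X j := M.X j ⧸ S.N j
  act i j k h :=
    { toFun := fun a => (S.N j).mapQ (S.N k) (M.act i h a) (fun x hx => S.act_mem i h a x hx)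
      map_zero' := by ext; simp
      map_add' := fun _ _ => by ext; simp }
  act_smul i _ _ h c a x := by
    induction x using Submodule.Quotient.induction_on with
    | H x => exact congrArg (Submodule.Quotient.mk) (M.act_smul i h c a x)
  act_one h x := by
    induction x using Submodule.Quotient.induction_on with
    | H x => exact congrArg (Submodule.Quotient.mk) (M.act_one h x)
  act_mul i i' _ _ _ h h' h'' a b x := by
    induction x using Submodule.Quotient.induction_on with
    | H x => exact congrArg (Submodule.Quotient.mk) (M.act_mul i i' h h' h'' a b x)

/-- The projection to the quotient. -/
def Sub.proj (S : Sub M) : M ⟶ S.quot :=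
  Hom.mk (fun j => (S.N j).mkQ) (fun _ _ _ _ _ _ => rfl)

/-- The graded module `0`. -/
def zeroObj : GrMod 𝓐 φ where
  X _ := PUnit
  act _ _ _ _ := 0
  act_smul _ _ _ _ _ _ _ := rfl
  act_one _ _ := rfl
  act_mul _ _ _ _ _ _ _ _ _ _ _ := rfl

theorem isZero_zeroObj : IsZero (zeroObj : GrMod 𝓐 φ) :=
  (IsZero.iff_id_eq_zero _).mpr (hom_ext fun _ _ => rfl)

instance : HasZeroObject (GrMod 𝓐 φ) := ⟨⟨zeroObj, isZero_zeroObj⟩⟩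

/-- The direct sum of two graded modules. -/
def prod (M N : GrMod 𝓐 φ) : GrMod 𝓐 φ where
  X j := M.X j × N.X j
  act i _ _ h :=
    { toFun := fun a => (M.act i h a).prodMap (N.act i h a)
      map_zero' := by ext <;> simp
      map_add' := fun _ _ => by ext <;> simp }
  act_smul i _ _ h c a x := Prod.ext (M.act_smul i h c a x.1) (N.act_smul i h c a x.2)
  act_one h x := Prod.ext (M.act_one h x.1) (N.act_one h x.2)
  act_mul i i' _ _ _ h h' h'' a b x :=
    Prod.ext (M.act_mul i i' h h' h'' a b x.1) (N.act_mul i i' h h' h'' a b x.2)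

/-- The direct sum as a bicone. -/
def bicone (M N : GrMod 𝓐 φ) : BinaryBicone M N where
  pt := prod M N
  fst := Hom.mk (fun _ => LinearMap.fst R _ _) (fun _ _ _ _ _ _ => rfl)
  snd := Hom.mk (fun _ => LinearMap.snd R _ _) (fun _ _ _ _ _ _ => rfl)
  inl := Hom.mk (fun _ => LinearMap.inl R _ _) (fun i _ _ h a _ =>
    Prod.ext rfl (map_zero (N.act i h a)).symm)
  inr := Hom.mk (fun _ => LinearMap.inr R _ _) (fun i _ _ h a _ =>
    Prod.ext (map_zero (M.act i h a)).symm rfl)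
  inl_fst := rfl
  inl_snd := rfl
  inr_fst := rfl
  inr_snd := rfl

instance : HasBinaryBiproducts (GrMod 𝓐 φ) where
  has_binary_biproduct M N := HasBinaryBiproduct.mk
    { bicone := bicone M N
      isBilimit := isBinaryBilimitOfTotal _ (hom_ext fun j x => by
        exact Prod.ext (add_zero (x : M.X j × N.X j).1) (zero_add (x : M.X j × N.X j).2)) }

instance : HasFiniteProducts (GrMod 𝓐 φ) :=
  hasFiniteProducts_of_has_binary_and_terminal

/-- The graded submodule of elements killed by `f`. -/
def ker (f : M ⟶ N) : Sub M where
  N j := LinearMap.ker (f.app j)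
  act_mem i _ _ h a x hx := by
    rw [LinearMap.mem_ker] at hx ⊢
    rw [f.comm, hx, map_zero]

/-- The image of `f`. -/
def range (f : M ⟶ N) : Sub N where
  N j := LinearMap.range (f.app j)
  act_mem i _ _ h a x hx := by
    obtain ⟨y, rfl⟩ := hx
    exact ⟨M.act i h a y, f.comm i h a y⟩

theorem ker_condition (f : M ⟶ N) : (ker f).incl ≫ f = 0 := hom_ext fun _ x => x.2

theorem range_condition (f : M ⟶ N) : f ≫ (range f).proj = 0 := hom_ext fun _ x =>
  (Submodule.Quotient.mk_eq_zero _).mpr ⟨x, rfl⟩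

/-- `ker f` is a kernel of `f`. -/
def isLimitKer (f : M ⟶ N) : IsLimit (KernelFork.ofι _ (ker_condition f)) :=
  KernelFork.IsLimit.ofι _ _
    (fun g hg => Hom.mk (fun j => (g.app j).codRestrict _ (fun x =>
        LinearMap.congr_fun (congrArg (fun t : _ ⟶ N => t.app j) hg) x))
      (fun i _ _ h a x => Subtype.ext (g.comm i h a x)))
    (fun _ _ => rfl)
    (fun _ _ _ hm => hom_ext fun j x => Subtype.ext
      (LinearMap.congr_fun (congrArg (fun t : _ ⟶ M => t.app j) hm) x))

theorem proj_surjective (S : Sub M) (j : ℤ) : Function.Surjective (S.proj.app j) :=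
  Submodule.mkQ_surjective _

/-- The map induced on a quotient. -/
def Sub.desc (S : Sub M) (g : M ⟶ P) (hg : ∀ j, S.N j ≤ LinearMap.ker (g.app j)) : S.quot ⟶ P :=
  Hom.mk (fun j => (S.N j).liftQ (g.app j) (hg j))
    (fun i j k h a x => by
      induction x using Submodule.Quotient.induction_on with
      | H x => exact g.comm i h a x)

/-- `N / range f` is a cokernel of `f`. -/
def isColimitRange (f : M ⟶ N) : IsColimit (CokernelCofork.ofπ _ (range_condition f)) :=
  CokernelCofork.IsColimit.ofπ _ _
    (fun g hg => (range f).desc g (fun j => by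
      rintro _ ⟨y, rfl⟩
      exact LinearMap.congr_fun (congrArg (fun t : M ⟶ _ => t.app j) hg) y))
    (fun _ _ => rfl)
    (fun _ _ _ hm => hom_ext fun j x => by
      obtain ⟨x, rfl⟩ := proj_surjective _ j x
      exact LinearMap.congr_fun (congrArg (fun t : N ⟶ _ => t.app j) hm) x)

instance : HasKernels (GrMod 𝓐 φ) := ⟨fun f => ⟨_, isLimitKer f⟩⟩
instance : HasCokernels (GrMod 𝓐 φ) := ⟨fun f => ⟨_, isColimitRange f⟩⟩

theorem mono_iff (f : M ⟶ N) : Mono f ↔ ∀ j, Function.Injective (f.app j) := by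
  constructor
  · intro _ j
    have h : (ker f).incl = 0 := by rw [← cancel_mono f, ker_condition, zero_comp]
    refine (injective_iff_map_eq_zero _).mpr fun x hx => ?_
    exact LinearMap.congr_fun (congrArg (fun t : _ ⟶ M => t.app j) h)
      (⟨x, hx⟩ : LinearMap.ker (f.app j))
  · intro h
    exact ⟨fun g g' hg => hom_ext fun j x => h j
      (LinearMap.congr_fun (congrArg (fun t : _ ⟶ N => t.app j) hg) x)⟩

theorem epi_iff (f : M ⟶ N) : Epi f ↔ ∀ j, Function.Surjective (f.app j) := by
  constructor
  · intro _ j x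
    have h : (range f).proj = 0 := by rw [← cancel_epi f, range_condition, comp_zero]
    exact (Submodule.Quotient.mk_eq_zero _).mp
      (LinearMap.congr_fun (congrArg (fun t : N ⟶ _ => t.app j) h) x)
  · intro h
    refine ⟨fun g g' hg => hom_ext fun j x => ?_⟩
    obtain ⟨x, rfl⟩ := h j x
    exact LinearMap.congr_fun (congrArg (fun t : M ⟶ _ => t.app j) hg) x

noncomputable instance : IsNormalMonoCategory (GrMod 𝓐 φ) where
  normalMonoOfMono {M N} f hf := ⟨{
    Z := (range f).quot
    g := (range f).proj
    w := range_condition f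
    isLimit := by
      have hinj := (mono_iff f).mp hf
      have key : ∀ {W : GrMod 𝓐 φ} (k : W ⟶ N) (_ : k ≫ (range f).proj = 0) (j : ℤ) (x : W.X j),
          k.app j x ∈ LinearMap.range (f.app j) := fun k hk j x =>
        (Submodule.Quotient.mk_eq_zero _).mp
          (LinearMap.congr_fun (congrArg (fun t : _ ⟶ (range f).quot => t.app j) hk) x)
      have spec : ∀ {W : GrMod 𝓐 φ} (k : W ⟶ N) (hk : k ≫ (range f).proj = 0) (j : ℤ) (x : W.X j),
          f.app j ((LinearEquiv.ofInjective (f.app j) (hinj j)).symm ⟨k.app j x, key k hk j x⟩)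
            = k.app j x := fun k hk j x => congrArg Subtype.val
        ((LinearEquiv.ofInjective (f.app j) (hinj j)).apply_symm_apply ⟨k.app j x, key k hk j x⟩)
      exact KernelFork.IsLimit.ofι _ _
        (fun {W} k hk => Hom.mk
          (fun j => (LinearEquiv.ofInjective (f.app j) (hinj j)).symm.toLinearMap ∘ₗ
            (k.app j).codRestrict _ (key k hk j))
          (fun i j l h a x => hinj _ (by
            refine (spec k hk l _).trans ?_
            rw [k.comm, f.comm]
            exact congrArg _ (spec k hk j x).symm)))
        (fun k hk => hom_ext fun j x => spec k hk j x)
        (fun k hk m hm => by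
          have := hf
          rw [← cancel_mono f, hm]
          exact (hom_ext fun j x => spec k hk j x).symm) }⟩

noncomputable instance : IsNormalEpiCategory (GrMod 𝓐 φ) where
  normalEpiOfEpi {M N} f hf := ⟨{
    W := (ker f).toGrMod
    g := (ker f).incl
    w := ker_condition f
    isColimit := by
      have hsurj := (epi_iff f).mp hf
      have key : ∀ {W : GrMod 𝓐 φ} (k : M ⟶ W) (_ : (ker f).incl ≫ k = 0) (j : ℤ),
          LinearMap.ker (f.app j) ≤ LinearMap.ker (k.app j) := fun k hk j x hx =>
        LinearMap.congr_fun (congrArg (fun t : (ker f).toGrMod ⟶ _ => t.app j) hk)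
          (⟨x, hx⟩ : LinearMap.ker (f.app j))
      have spec : ∀ {W : GrMod 𝓐 φ} (k : M ⟶ W) (hk : (ker f).incl ≫ k = 0) (j : ℤ) (x : M.X j),
          (LinearMap.ker (f.app j)).liftQ (k.app j) (key k hk j)
            (((f.app j).quotKerEquivOfSurjective (hsurj j)).symm (f.app j x)) = k.app j x :=
        fun k hk j x => by
          rw [show ((f.app j).quotKerEquivOfSurjective (hsurj j)).symm (f.app j x)
              = Submodule.Quotient.mk x from
            (LinearEquiv.symm_apply_eq _).mpr rfl]
          rfl
      exact CokernelCofork.IsColimit.ofπ _ _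
        (fun {W} k hk => Hom.mk
          (fun j => (LinearMap.ker (f.app j)).liftQ (k.app j) (key k hk j) ∘ₗ
            ((f.app j).quotKerEquivOfSurjective (hsurj j)).symm.toLinearMap)
          (fun i j l h a x => by
            obtain ⟨x, rfl⟩ := hsurj j x
            rw [← f.comm]
            refine (spec k hk l _).trans ?_
            rw [k.comm]
            exact congrArg _ (spec k hk j x).symm))
        (fun k hk => hom_ext fun j x => spec k hk j x)
        (fun k hk m hm => by
          have := hf
          rw [← cancel_epi f, hm]
          exact (hom_ext fun j x => spec k hk j x).symm) }⟩

noncomputable instance : Abelian (GrMod 𝓐 φ) where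

/-- `Ext` groups exist, in the universe given by the construction of the derived category. -/
instance : HasExt.{u + 1} (GrMod 𝓐 φ) := HasExt.standard _

/-- The submodule `M_{≥ p}` of the elements of degree at least `p`. -/
def geSub (M : GrMod 𝓐 φ) (p : ℤ) : Sub M where
  N j := if p ≤ j then ⊤ else ⊥
  act_mem i j k h a x hx := by
    split_ifs with hk
    · trivial
    · rw [if_neg (by omega)] at hx
      rw [(Submodule.mem_bot R).mp hx, map_zero]
      exact Submodule.zero_mem _

/-- The truncation `M_{≤ q} = M / M_{≥ q + 1}`, as a functor. -/
def truncLE (q : ℤ) : GrMod 𝓐 φ ⥤ GrMod 𝓐 φ where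
  obj M := (M.geSub (q + 1)).quot
  map {M N} f := (M.geSub (q + 1)).desc (f ≫ (N.geSub (q + 1)).proj) (fun j x hx => by
    refine (Submodule.Quotient.mk_eq_zero _).mpr ?_
    change x ∈ (if q + 1 ≤ j then ⊤ else ⊥ : Submodule R (M.X j)) at hx
    change f.app j x ∈ (if q + 1 ≤ j then ⊤ else ⊥ : Submodule R (N.X j))
    split_ifs at hx ⊢
    · trivial
    · rw [(Submodule.mem_bot R).mp hx, map_zero]
      exact Submodule.zero_mem _)
  map_id M := hom_ext fun j x => by
    obtain ⟨x, rfl⟩ := proj_surjective _ j x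
    rfl
  map_comp f g := hom_ext fun j x => by
    obtain ⟨x, rfl⟩ := proj_surjective _ j x
    rfl

instance (q : ℤ) : (truncLE q : GrMod 𝓐 φ ⥤ GrMod 𝓐 φ).Additive where
  map_add := hom_ext fun j x => by
    obtain ⟨x, rfl⟩ := proj_surjective _ j x
    rfl

instance (q : ℤ) : (truncLE q : GrMod 𝓐 φ ⥤ GrMod 𝓐 φ).Linear R where
  map_smul f r := hom_ext fun j x => by
    obtain ⟨x, rfl⟩ := proj_surjective _ j x
    rfl

theorem exact_iff (S : ShortComplex (GrMod 𝓐 φ)) :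
    S.Exact ↔ ∀ j x, S.g.app j x = 0 → ∃ y, S.f.app j y = x := by
  rw [S.exact_iff_kernel_ι_comp_cokernel_π_zero]
  have e1 : kernel.ι S.g = (IsLimit.conePointUniqueUpToIso (kernelIsKernel S.g)
      (isLimitKer S.g)).hom ≫ (ker S.g).incl :=
    (IsLimit.conePointUniqueUpToIso_hom_comp (kernelIsKernel S.g) (isLimitKer S.g)
      WalkingParallelPair.zero).symm
  have e2 : cokernel.π S.f = (range S.f).proj ≫
      (IsColimit.coconePointUniqueUpToIso (isColimitRange S.f) (cokernelIsCokernel S.f)).hom :=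
    (IsColimit.comp_coconePointUniqueUpToIso_hom (isColimitRange S.f) (cokernelIsCokernel S.f)
      WalkingParallelPair.one).symm
  rw [e1, e2]
  simp only [Category.assoc, Preadditive.IsIso.comp_left_eq_zero]
  rw [← Category.assoc, Preadditive.IsIso.comp_right_eq_zero]
  constructor
  · intro h j x hx
    exact (Submodule.Quotient.mk_eq_zero _).mp
      (LinearMap.congr_fun (congrArg (fun t : (ker S.g).toGrMod ⟶ (range S.f).quot => t.app j) h)
        (⟨x, hx⟩ : LinearMap.ker (S.g.app j)))
  · intro h
    exact hom_ext fun j x => (Submodule.Quotient.mk_eq_zero _).mpr (h j x.1 x.2)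

theorem truncLE_exact (q : ℤ) (S : ShortComplex (GrMod 𝓐 φ)) (hS : S.Exact) :
    (S.map (truncLE q)).Exact := by
  rw [exact_iff] at hS ⊢
  intro j x hx
  obtain ⟨x, rfl⟩ := proj_surjective _ j x
  have hx' : S.g.app j x ∈ (if q + 1 ≤ j then ⊤ else ⊥ : Submodule R (S.X₃.X j)) :=
    (Submodule.Quotient.mk_eq_zero _).mp hx
  by_cases hj : q + 1 ≤ j
  · refine ⟨0, (map_zero _).trans (Eq.symm ((Submodule.Quotient.mk_eq_zero _).mpr ?_))⟩
    change x ∈ (if q + 1 ≤ j then ⊤ else ⊥ : Submodule R (S.X₂.X j))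
    rw [if_pos hj]
    trivial
  · rw [if_neg hj, Submodule.mem_bot] at hx'
    obtain ⟨y, rfl⟩ := hS j x hx'
    exact ⟨(S.X₁.geSub (q + 1)).proj.app j y, rfl⟩

theorem truncLE_preserves (q : ℤ) :
    PreservesFiniteLimits (truncLE q : GrMod 𝓐 φ ⥤ GrMod 𝓐 φ) ∧
      PreservesFiniteColimits (truncLE q : GrMod 𝓐 φ ⥤ GrMod 𝓐 φ) :=
  ((Functor.exact_tfae (truncLE q : GrMod 𝓐 φ ⥤ GrMod 𝓐 φ)).out 1 3).mp (truncLE_exact q)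

instance (q : ℤ) : PreservesFiniteLimits (truncLE q : GrMod 𝓐 φ ⥤ GrMod 𝓐 φ) :=
  (truncLE_preserves q).1

instance (q : ℤ) : PreservesFiniteColimits (truncLE q : GrMod 𝓐 φ ⥤ GrMod 𝓐 φ) :=
  (truncLE_preserves q).2

/-- The canonical map `Ext^{i,0}(M, N) → Ext^{i,0}(M_{≤ q}, N_{≤ q})`, induced by the exact
functor of truncation; `Ext` is taken in the abelian category of graded modules. -/
noncomputable def extTrunc (M N : GrMod 𝓐 φ) (i : ℕ) (q : ℤ) :
    Abelian.Ext M N i →ₗ[R] Abelian.Ext ((truncLE q).obj M) ((truncLE q).obj N) i :=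
  (truncLE q).mapExtLinearMap R M N i

/-- The graded module is generated by finitely many homogeneous elements. -/
def FinGen (M : GrMod 𝓐 φ) : Prop :=
  ∃ (n : ℕ) (d : Fin n → ℤ) (x : ∀ t, M.X (d t)), ∀ j,
    Submodule.span R {y | ∃ (t : Fin n) (i : ℕ) (h : (i : ℤ) + d t = j) (a : 𝓐 i),
      y = M.act i h a (x t)} = ⊤

/-- The base change `R' ⊗_R M` along `ψ : R → R'`. -/
noncomputable def baseChange {R' : Type u} [CommRing R'] (M : GrMod 𝓐 φ) (ψ : R →+* R') :
    GrMod 𝓐 (ψ.comp φ) :=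
  letI := ψ.toAlgebra
  { X := fun j => R' ⊗[R] M.X j
    act := fun i _ _ h =>
      { toFun := fun a => (M.act i h a).baseChange R'
        map_zero' := by simp
        map_add' := fun _ _ => by simp }
    act_smul := fun i _ _ h c a x => by
      induction x using TensorProduct.induction_on with
      | zero => simp
      | add x y hx hy => simp only [map_add, smul_add, hx, hy]
      | tmul r x =>
        change r ⊗ₜ[R] M.act i h (c • a) x = (ψ (φ c) * r) ⊗ₜ[R] M.act i h a x
        rw [M.act_smul, ← TensorProduct.smul_tmul]
        rfl
    act_one := fun h x => by
      induction x using TensorProduct.induction_on with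
      | zero => simp
      | add x y hx hy => rw [map_add, hx, hy]
      | tmul r x => exact congrArg (r ⊗ₜ[R] ·) (M.act_one h x)
    act_mul := fun i i' _ _ _ h h' h'' a b x => by
      induction x using TensorProduct.induction_on with
      | zero => simp
      | add x y hx hy => rw [map_add, hx, hy, map_add, map_add]
      | tmul r x => exact congrArg (r ⊗ₜ[R] ·) (M.act_mul i i' h h' h'' a b x) }

end GrMod

section Families

variable {K A : Type u} [Field K] [CommRing A] [Algebra K A]

/-- The homomorphism `K → Γ(S, U)` for an open subset `U` of a `K`-scheme `S`. -/
noncomputable def sectionScalars {S : Scheme.{u}} (f : S ⟶ Spec (CommRingCat.of K))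
    (U : S.Opens) : K →+* Γ(S, U) :=
  ((Scheme.ΓSpecIso (CommRingCat.of K)).inv ≫ f.appTop ≫
    S.presheaf.map (homOfLE le_top : U ⟶ ⊤).op).hom

/-- The homomorphism `K → 𝒪_{S, s}` for a point `s` of a `K`-scheme `S`. -/
noncomputable def stalkScalars {S : Scheme.{u}} (f : S ⟶ Spec (CommRingCat.of K))
    (s : S) : K →+* S.presheaf.stalk s :=
  (S.presheaf.germ ⊤ s trivial).hom.comp (sectionScalars f ⊤)

/-- A graded sheaf of `A ⊗_K 𝒪_S`-modules on a `K`-scheme `S`: a family of `𝒪_S`-modules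
`comp j`, with `𝒪_S`-linear actions `𝓐 i ⊗_K comp j → comp (i + j)`. -/
structure GrSheaf (𝓐 : ℕ → Submodule K A) [GradedAlgebra 𝓐] {S : Scheme.{u}}
    (f : S ⟶ Spec (CommRingCat.of K)) where
  /-- the component of degree `j` -/
  comp : ℤ → S.Modules
  /-- the action of the elements of degree `i` of `A` -/
  act : ∀ (i : ℕ) {j k : ℤ}, (i : ℤ) + j = k → 𝓐 i →+ (comp j ⟶ comp k)
  act_smul : ∀ (i : ℕ) {j k : ℤ} (h : (i : ℤ) + j = k) (c : K) (a : 𝓐 i) (U : S.Opens)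
    (x : Γ(comp j, U)),
    (act i h (c • a)).app U x = sectionScalars f U c • (act i h a).app U x
  act_one : ∀ {j : ℤ} (h : ((0 : ℕ) : ℤ) + j = j),
    act 0 h ⟨1, SetLike.GradedOne.one_mem⟩ = 𝟙 (comp j)
  act_mul : ∀ (i i' : ℕ) {j k l : ℤ} (h : (i' : ℤ) + j = k) (h' : (i : ℤ) + k = l)
    (h'' : ((i + i' : ℕ) : ℤ) + j = l) (a : 𝓐 i) (b : 𝓐 i'),
    act (i + i') h'' ⟨a.1 * b.1, SetLike.GradedMul.mul_mem a.2 b.2⟩ = act i' h b ≫ act i h' a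

namespace GrSheaf

variable {𝓐 : ℕ → Submodule K A} [GradedAlgebra 𝓐] {S : Scheme.{u}}
  {f : S ⟶ Spec (CommRingCat.of K)}

/-- The graded module of sections over an open subset `U`. -/
noncomputable def sections (M : GrSheaf 𝓐 f) (U : S.Opens) : GrMod 𝓐 (sectionScalars f U) where
  X j := Γ(M.comp j, U)
  act i _ _ h :=
    { toFun := fun a =>
        { toFun := fun x => (M.act i h a).app U x
          map_add' := fun x y => map_add _ x y
          map_smul' := fun r x => Scheme.Modules.Hom.app_smul (M.act i h a) r x }
      map_zero' := by
        ext x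
        change (M.act i h 0).app U x = 0
        rw [map_zero]
        rfl
      map_add' := fun a b => by
        ext x
        change (M.act i h (a + b)).app U x = (M.act i h a).app U x + (M.act i h b).app U x
        rw [map_add]
        rfl }
  act_smul i _ _ h c a x := M.act_smul i h c a U x
  act_one h x := by
    change (M.act 0 h _).app U x = x
    rw [M.act_one]
    rfl
  act_mul i i' _ _ _ h h' h'' a b x := by
    change (M.act (i + i') h'' _).app U x = (M.act i h' a).app U ((M.act i' h b).app U x)
    rw [M.act_mul i i' h h' h'']
    rfl

/-- The stalk of an `𝒪_S`-module at `s` is an `𝒪_{S, s}`-module. -/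
noncomputable instance instModuleStalk (F : S.Modules) (s : S) :
    Module (S.presheaf.stalk s) (F.presheaf.stalk s) :=
  PresheafOfModules.instModuleCarrierStalkCommRingCatCarrierAbPresheafOpensCarrier
    (X := S.toTopCat) (R := S.presheaf) F.val s

/-- The map on stalks. -/
noncomputable def stalkMap {F G : S.Modules} (g : F ⟶ G) (s : S) :
    F.presheaf.stalk s ⟶ G.presheaf.stalk s :=
  (TopCat.Presheaf.stalkFunctor Ab s).map g.mapPresheaf

theorem stalkMap_germ {F G : S.Modules} (g : F ⟶ G) (s : S) (U : S.Opens) (hs : s ∈ U)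
    (x : Γ(F, U)) :
    stalkMap g s (F.presheaf.germ U s hs x) = G.presheaf.germ U s hs (g.app U x) :=
  TopCat.Presheaf.stalkFunctor_map_germ_apply U s hs g.mapPresheaf x

theorem germ_smul (F : S.Modules) (s : S) (U : S.Opens) (hs : s ∈ U) (r : Γ(S, U))
    (x : Γ(F, U)) :
    F.presheaf.germ U s hs (r • x) = S.presheaf.germ U s hs r • F.presheaf.germ U s hs x :=
  PresheafOfModules.germ_smul F.val s U hs r x

theorem exists_germ_le (F : S.Modules) (s : S) (U : S.Opens) (hU : s ∈ U)
    (x : F.presheaf.stalk s) : ∃ (V : S.Opens) (_ : V ≤ U) (hV : s ∈ V) (y : Γ(F, V)),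
    F.presheaf.germ V s hV y = x := by
  obtain ⟨W, hW, y, rfl⟩ := TopCat.Presheaf.exists_germ_eq F.presheaf x
  exact ⟨U ⊓ W, inf_le_left, ⟨hU, hW⟩, F.presheaf.map (homOfLE inf_le_right).op y,
    TopCat.Presheaf.germ_res_apply F.presheaf (homOfLE inf_le_right) s ⟨hU, hW⟩ y⟩

theorem stalkMap_smul {F G : S.Modules} (g : F ⟶ G) (s : S) (r : S.presheaf.stalk s)
    (x : F.presheaf.stalk s) : stalkMap g s (r • x) = r • stalkMap g s x := by
  obtain ⟨U, hU, r, rfl⟩ := TopCat.Presheaf.exists_germ_eq S.presheaf r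
  obtain ⟨V, hVU, hV, x, rfl⟩ := exists_germ_le F s U hU x
  rw [← TopCat.Presheaf.germ_res_apply S.presheaf (homOfLE hVU) s hV r, ← germ_smul,
    stalkMap_germ, stalkMap_germ, ← germ_smul, Scheme.Modules.Hom.app_smul]

/-- The graded module of stalks at `s`. -/
noncomputable def stalk (M : GrSheaf 𝓐 f) (s : S) : GrMod 𝓐 (stalkScalars f s) where
  X j := (M.comp j).presheaf.stalk s
  act i _ _ h :=
    { toFun := fun a =>
        { toFun := fun x => stalkMap (M.act i h a) s x
          map_add' := fun x y => map_add _ x y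
          map_smul' := fun r x => stalkMap_smul (M.act i h a) s r x }
      map_zero' := by
        ext x
        change stalkMap (M.act i h 0) s x = 0
        obtain ⟨U, hU, x, rfl⟩ := TopCat.Presheaf.exists_germ_eq (M.comp _).presheaf x
        rw [stalkMap_germ, map_zero, Scheme.Modules.Hom.zero_app]
        exact map_zero _
      map_add' := fun a b => by
        ext x
        change stalkMap (M.act i h (a + b)) s x
          = stalkMap (M.act i h a) s x + stalkMap (M.act i h b) s x
        obtain ⟨U, hU, x, rfl⟩ := TopCat.Presheaf.exists_germ_eq (M.comp _).presheaf x
        rw [stalkMap_germ, stalkMap_germ, stalkMap_germ, map_add, Scheme.Modules.Hom.add_app]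
        exact map_add _ _ _ }
  act_smul i _ _ h c a x := by
    change stalkMap (M.act i h (c • a)) s x = stalkScalars f s c • stalkMap (M.act i h a) s x
    obtain ⟨U, hU, x, rfl⟩ := TopCat.Presheaf.exists_germ_eq (M.comp _).presheaf x
    rw [stalkMap_germ, stalkMap_germ, M.act_smul, germ_smul]
    congr 1
    change _ = S.presheaf.germ ⊤ s trivial (sectionScalars f ⊤ c)
    rw [← TopCat.Presheaf.germ_res_apply S.presheaf (homOfLE le_top : U ⟶ ⊤) s hU]
    simp [sectionScalars]
  act_one h x := by
    change stalkMap (M.act 0 h _) s x = x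
    obtain ⟨U, hU, x, rfl⟩ := TopCat.Presheaf.exists_germ_eq (M.comp _).presheaf x
    rw [stalkMap_germ, M.act_one]
    rfl
  act_mul i i' _ _ _ h h' h'' a b x := by
    change stalkMap (M.act (i + i') h'' _) s x
      = stalkMap (M.act i h' a) s (stalkMap (M.act i' h b) s x)
    obtain ⟨U, hU, x, rfl⟩ := TopCat.Presheaf.exists_germ_eq (M.comp _).presheaf x
    rw [stalkMap_germ, stalkMap_germ, stalkMap_germ, M.act_mul i i' h h' h'']
    rfl

/-- The scalars `K → κ(s)` for a point `s` of a `K`-scheme `S`. -/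
noncomputable abbrev residueScalars (f : S ⟶ Spec (CommRingCat.of K)) (s : S) :
    K →+* S.residueField s :=
  (S.residue s).hom.comp (stalkScalars f s)

/-- The fibre at `s`, a graded module over `κ(s) ⊗_K A`, with components
`κ(s) ⊗_{𝒪_{S, s}} (comp j)_s`. -/
noncomputable def fiber (M : GrSheaf 𝓐 f) (s : S) : GrMod 𝓐 (residueScalars f s) :=
  (M.stalk s).baseChange (S.residue s).hom

/-- `M` is locally generated over `A ⊗_K 𝒪_S` by finitely many homogeneous sections. -/
def FiniteType (M : GrSheaf 𝓐 f) : Prop :=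
  ∀ s : S, ∃ U : S.Opens, IsAffineOpen U ∧ s ∈ U ∧ (M.sections U).FinGen

end GrSheaf

/-- `𝒪_S`-modules that are locally free of finite rank. -/
def IsVectorBundle {S : Scheme.{u}} (F : S.Modules) : Prop :=
  ∀ s : S, ∃ U : S.Opens, s ∈ U ∧ ∃ n : ℕ,
    Nonempty (F.restrict U.ι ≅
      (SheafOfModules.free (R := (U : Scheme.{u}).ringCatSheaf) (ULift.{u} (Fin n)) :
        (U : Scheme.{u}).Modules))

/-- A family of finitely generated graded `A`-modules parametrized by `S`: a graded sheaf of
`A ⊗_K 𝒪_S`-modules, of finite type, whose components are vector bundles on `S`. -/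
structure GrSheaf.IsFamily {𝓐 : ℕ → Submodule K A} [GradedAlgebra 𝓐] {S : Scheme.{u}}
    {f : S ⟶ Spec (CommRingCat.of K)} (M : GrSheaf 𝓐 f) : Prop where
  vectorBundle : ∀ j, IsVectorBundle (M.comp j)
  finiteType : M.FiniteType

attribute [local instance] MvPolynomial.gradedAlgebra

/-- Projective `K`-schemes: closed subschemes of some projective space `ℙ^n` over `K`. -/
def IsProjectiveScheme {S : Scheme.{u}} (f : S ⟶ Spec (CommRingCat.of K)) : Prop :=
  ∃ (n : ℕ) (ι : S ⟶ Proj (MvPolynomial.homogeneousSubmodule (Fin (n + 1)) K)),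
    IsClosedImmersion ι ∧
      ι ≫ Proj.toSpecZero (MvPolynomial.homogeneousSubmodule (Fin (n + 1)) K) ≫
        Spec.map (CommRingCat.ofHom
          (algebraMap K (MvPolynomial.homogeneousSubmodule (Fin (n + 1)) K 0))) = f

end Families

/-! Write M_{>q} for the part of degree > q. The projections to the truncations are natural, so the
canonical map followed by pullback along M → M_{≤q} is the pushforward Ext^i(M, N) → Ext^i(M,
N_{≤q}) (`mk₀_comp_mapExactFunctor`). The pullback is always bijective, since Ext^n(M_{>q}, N_{≤q})
= 0 for all n (`ext_subsingleton_of_degrees`). The pushforward is bijective as soon as Ext^i(M,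
N_{>q}) and Ext^{i+1}(M, N_{>q}) vanish. This reduces the theorem to a vanishing statement
(`extTrunc_bijective`).

For the vanishing, resolve M by free modules on finitely many homogeneous generators; the syzygies
are finitely generated because R ⊗ A is noetherian. By dimension shifting, Ext^n(M, N_{>q}) is a
quotient of Hom(Z, N_{>q}), where Z is the n-th syzygy, and this is zero once q bounds the degrees
of generators of Z.

If the components of M are flat over the noetherian base R, so are those of all syzygies. The
resolution then stays exact under every base change R → R', with generators in the same degrees, so
a single q serves all base changes (`FinGen.exists_ext_baseChange_subsingleton`). Part (1) is the
case R = R' = K. In part (2), vector bundles are quasi-coherent with flat sections over affine opens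
U, and the fibre at s ∈ U is the base change of the sections over U to κ(s)
(`IsFamily.nonempty_fiber_iso`). A projective scheme is noetherian, so finitely many U suffice, and
a common bound exists. -/

/-! ### Dimension shifting, and Ext under exact functors -/

namespace CategoryTheory.Abelian.Ext

universe w w' v v' u₁ u₂

variable {C : Type u₁} [Category.{v} C] [Abelian C] [HasExt.{w} C]

/-- A class of positive degree that dies on an epimorphism comes from the kernel. -/
theorem exists_extClass_comp {S : ShortComplex C} (hS : S.ShortExact) {Y : C} {n : ℕ}
    (e : Ext S.X₃ Y (n + 1)) (he : (Ext.mk₀ S.g).comp e (zero_add _) = 0) :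
    ∃ e' : Ext S.X₁ Y n, hS.extClass.comp e' (add_comm 1 n) = e :=
  contravariant_sequence_exact₃ hS Y e he (add_comm 1 n)

theorem shortExact_kernel {C : Type u₁} [Category.{v} C] [Abelian C] {X Y : C} (p : X ⟶ Y) [Epi p] :
    (ShortComplex.mk (kernel.ι p) p (kernel.condition p)).ShortExact where
  exact := ShortComplex.exact_kernel p

/-- Two commutative squares, one for a class of degree 1 and one for a class of degree n, paste
along `c`; this is the inductive step of the naturality below. -/
theorem mk₀_comp_comp_of_comm {X X' Z Z' Y Y' : C} {a : X ⟶ X'} {c : Z ⟶ Z'} {b : Y ⟶ Y'}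
    {x : Ext X Z 1} {x' : Ext X' Z' 1}
    (hx : x.comp (Ext.mk₀ c) (add_zero 1) = (Ext.mk₀ a).comp x' (zero_add 1))
    {n m : ℕ} {h : 1 + n = m} {e : Ext Z Y n} {e' : Ext Z' Y' n}
    (he : (Ext.mk₀ c).comp e' (zero_add n) = e.comp (Ext.mk₀ b) (add_zero n)) :
    (Ext.mk₀ a).comp (x'.comp e' h) (zero_add m) = (x.comp e h).comp (Ext.mk₀ b) (add_zero m) := by
  rw [Ext.comp_assoc x e _ h (add_zero n) (by omega), ← he,
    ← Ext.comp_assoc _ _ _ (zero_add 1) h (by omega), ← hx,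
    Ext.comp_assoc _ _ _ (add_zero 1) (zero_add n) (by omega)]

/-- A natural transformation from the identity to an exact functor `F` is compatible with the maps
induced by `F` on `Ext`. -/
theorem mk₀_comp_mapExactFunctor [EnoughProjectives C] (F : C ⥤ C) [F.Additive]
    [PreservesFiniteLimits F] [PreservesFiniteColimits F] (η : 𝟭 C ⟶ F) (n : ℕ) :
    ∀ {X Y : C} (e : Ext X Y n),
      (Ext.mk₀ (η.app X)).comp (e.mapExactFunctor F) (zero_add n) =
        e.comp (Ext.mk₀ (η.app Y)) (add_zero n) := by
  induction n with
  | zero =>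
    intro X Y e
    obtain ⟨f, rfl⟩ := (Ext.mk₀_bijective X Y).2 e
    rw [mapExactFunctor_mk₀, Ext.mk₀_comp_mk₀, Ext.mk₀_comp_mk₀]
    exact congrArg _ (η.naturality f).symm
  | succ n ih =>
    intro X Y e
    have hS := shortExact_kernel (Projective.π X)
    -- Positive Ext of a projective vanishes, so `e` is the extension class times a class of degree
    -- n.
    obtain ⟨e', rfl⟩ := exists_extClass_comp hS e (Ext.eq_zero_of_projective _)
    -- `η` maps the short exact sequence to its image under `F`; naturality of extension classes
    -- settles the factor of degree 1.
    let f : ShortComplex.mk (kernel.ι (Projective.π X)) (Projective.π X) (kernel.condition _) ⟶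
        (ShortComplex.mk (kernel.ι (Projective.π X)) (Projective.π X) (kernel.condition _)).map F :=
      { τ₁ := η.app _
        τ₂ := η.app _
        τ₃ := η.app _
        comm₁₂ := (η.naturality _).symm
        comm₂₃ := (η.naturality _).symm }
    have h := ShortComplex.ShortExact.extClass_naturality hS (hS.map_of_exact F) f
    rw [mapExactFunctor_comp, mapExactFunctor_extClass _ hS]
    exact mk₀_comp_comp_of_comm h (ih e')

end CategoryTheory.Abelian.Ext

/-! ### Truncation and Ext of graded modules -/

namespace GrMod

variable {K A R : Type u} [Field K] [CommRing A] [Algebra K A] [CommRing R]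
  {𝓐 : ℕ → Submodule K A} [GradedAlgebra 𝓐] {φ : K →+* R}

/-- The short exact sequence of a graded submodule. -/
abbrev Sub.shortComplex {M : GrMod 𝓐 φ} (S : Sub M) : ShortComplex (GrMod 𝓐 φ) :=
  ShortComplex.mk S.incl S.proj (hom_ext fun _ x => (Submodule.Quotient.mk_eq_zero _).mpr x.2)

theorem Sub.shortExact {M : GrMod 𝓐 φ} (S : Sub M) : S.shortComplex.ShortExact where
  exact := (exact_iff _).mpr fun _ x hx => ⟨⟨x, (Submodule.Quotient.mk_eq_zero _).mp hx⟩, rfl⟩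
  mono_f := (mono_iff _).mpr fun _ => Subtype.val_injective
  epi_g := (epi_iff _).mpr (proj_surjective S)

theorem ker_shortExact {M N : GrMod 𝓐 φ} (f : M ⟶ N) (hf : ∀ j, Function.Surjective (f.app j)) :
    (ShortComplex.mk (ker f).incl f (ker_condition f)).ShortExact where
  exact := (exact_iff _).mpr fun _ x hx => ⟨⟨x, hx⟩, rfl⟩
  mono_f := (mono_iff _).mpr fun _ => Subtype.val_injective
  epi_g := (epi_iff _).mpr hf

/-- The projections `M ⟶ M_{≤ q}`. -/
def toTruncLE (q : ℤ) : 𝟭 (GrMod 𝓐 φ) ⟶ truncLE q where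
  app M := (M.geSub (q + 1)).proj
  naturality _ _ _ := rfl

theorem geSub_subsingleton (M : GrMod 𝓐 φ) {p j : ℤ} (h : j < p) :
    Subsingleton ((M.geSub p).toGrMod.X j) := by
  change Subsingleton (if p ≤ j then ⊤ else ⊥ : Submodule R (M.X j))
  rw [if_neg (by omega)]
  infer_instance

theorem truncLE_subsingleton (M : GrMod 𝓐 φ) {q j : ℤ} (h : q < j) :
    Subsingleton (((truncLE q).obj M).X j) := by
  change Subsingleton (M.X j ⧸ (if q + 1 ≤ j then ⊤ else ⊥ : Submodule R (M.X j)))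
  rw [if_pos (by omega)]
  infer_instance

theorem mem_geSub (M : GrMod 𝓐 φ) {p j : ℤ} (h : p ≤ j) (x : M.X j) : x ∈ (M.geSub p).N j := by
  change x ∈ (if p ≤ j then ⊤ else ⊥ : Submodule R (M.X j))
  rw [if_pos h]
  trivial

/-- A homomorphism between modules without a common degree is zero. -/
theorem hom_eq_zero_of_subsingleton {M N : GrMod 𝓐 φ} (f : M ⟶ N)
    (h : ∀ j, Subsingleton (M.X j) ∨ Subsingleton (N.X j)) : f = 0 := hom_ext fun j x => by
  rcases h j with h | h
  · rw [Subsingleton.elim x 0, map_zero, map_zero]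
  · exact Subsingleton.elim _ _

theorem ext_zero_subsingleton_of_hom {M N : GrMod 𝓐 φ} (h : ∀ f : M ⟶ N, f = 0) :
    Subsingleton (Abelian.Ext M N 0) := by
  refine ⟨fun a b => ?_⟩
  obtain ⟨f, rfl⟩ := (Abelian.Ext.mk₀_bijective M N).2 a
  obtain ⟨g, rfl⟩ := (Abelian.Ext.mk₀_bijective M N).2 b
  rw [h f, h g]

/-- There are no extensions between modules in degrees `> q` and modules in degrees `≤ q`. -/
theorem ext_subsingleton_of_degrees [EnoughProjectives (GrMod 𝓐 φ)] (q : ℤ) (n : ℕ) :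
    ∀ {M N : GrMod 𝓐 φ}, (∀ j ≤ q, Subsingleton (M.X j)) → (∀ j, q < j → Subsingleton (N.X j)) →
      Subsingleton (Abelian.Ext M N n) := by
  induction n with
  | zero =>
    intro M N hM hN
    exact ext_zero_subsingleton_of_hom fun f => hom_eq_zero_of_subsingleton f fun j =>
      (le_or_gt j q).imp (hM j) (hN j)
  | succ n ih =>
    intro M N hM hN
    let P := Projective.over M
    -- The part of P in degrees > q need not be projective, but it still covers M, and positive Ext
    -- classes of M die on it because the map to M factors through P.
    let p : (P.geSub (q + 1)).toGrMod ⟶ M := (P.geSub (q + 1)).incl ≫ Projective.π M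
    have hp : ∀ j, Function.Surjective (p.app j) := fun j x => by
      rcases le_or_gt j q with hj | hj
      · exact ⟨0, have := hM j hj; Subsingleton.elim _ _⟩
      · obtain ⟨y, hy⟩ := (epi_iff (Projective.π M)).mp inferInstance j x
        exact ⟨⟨y, P.mem_geSub (by omega) y⟩, hy⟩
    refine subsingleton_of_forall_eq 0 fun e => ?_
    have hS := ker_shortExact p hp
    obtain ⟨e', rfl⟩ := Abelian.Ext.exists_extClass_comp hS e (by
      change (Abelian.Ext.mk₀ ((P.geSub (q + 1)).incl ≫ Projective.π M)).comp e _ = 0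
      rw [← Abelian.Ext.mk₀_comp_mk₀_assoc,
        Abelian.Ext.eq_zero_of_projective ((Abelian.Ext.mk₀ (Projective.π M)).comp e (zero_add _)),
        Abelian.Ext.comp_zero])
    -- The kernel lies in the truncated cover, hence again in degrees > q.
    have : Subsingleton (Abelian.Ext (ker p).toGrMod N n) := ih (fun j hj => by
      have := P.geSub_subsingleton (p := q + 1) (j := j) (by omega)
      exact inferInstanceAs (Subsingleton (LinearMap.ker (p.app j)))) hN
    rw [Subsingleton.elim e' 0, Abelian.Ext.comp_zero]

/-- The truncation map on `Ext` is bijective if there are no extensions of `M` by `N_{> q}`. -/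
theorem extTrunc_bijective [EnoughProjectives (GrMod 𝓐 φ)] (M N : GrMod 𝓐 φ) (i : ℕ) (q : ℤ)
    (h : Subsingleton (Abelian.Ext M (N.geSub (q + 1)).toGrMod i))
    (h' : Subsingleton (Abelian.Ext M (N.geSub (q + 1)).toGrMod (i + 1))) :
    Function.Bijective (extTrunc M N i q) := by
  let post : Abelian.Ext M N i →+ Abelian.Ext M ((truncLE q).obj N) i :=
    (Abelian.Ext.mk₀ ((toTruncLE q).app N)).postcomp M (add_zero i)
  let pre : Abelian.Ext ((truncLE q).obj M) ((truncLE q).obj N) i →+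
      Abelian.Ext M ((truncLE q).obj N) i :=
    (Abelian.Ext.mk₀ ((toTruncLE q).app M)).precomp _ (zero_add i)
  have hcomp : pre ∘ extTrunc M N i q = ⇑post := funext fun e =>
    Abelian.Ext.mk₀_comp_mapExactFunctor (truncLE q) (toTruncLE q) i e
  have orth : ∀ n, Subsingleton
      (Abelian.Ext (M.geSub (q + 1)).toGrMod ((truncLE q).obj N) n) := fun n =>
    ext_subsingleton_of_degrees q n (fun j hj => M.geSub_subsingleton (by omega))
      (fun j hj => N.truncLE_subsingleton hj)
  have hSM := (M.geSub (q + 1)).shortExact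
  have hSN := (N.geSub (q + 1)).shortExact
  -- In the long exact sequence of N, the neighbours of this map are the groups Ext^i and Ext^{i+1}
  -- of M with N_{>q}, both zero.
  have hpost : Function.Bijective post := by
    constructor
    · rw [injective_iff_map_eq_zero]
      intro a ha
      obtain ⟨c, hc⟩ := Abelian.Ext.covariant_sequence_exact₂ M hSN a ha
      rw [← hc]
      exact (congrArg (fun c => Abelian.Ext.comp c _ _) (Subsingleton.elim c 0)).trans
        (Abelian.Ext.zero_comp _ _ _ _ _)
    · intro b
      exact Abelian.Ext.covariant_sequence_exact₃ M hSN b rfl (Subsingleton.elim _ _)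
  have hpre : Function.Bijective pre := by
    constructor
    · rw [injective_iff_map_eq_zero]
      intro a ha
      -- In degree 0 injectivity says that M → M_{≤q} is an epimorphism; in degree n + 1 the
      -- preceding term Ext^n(M_{>q}, N_{≤q}) is zero.
      cases i with
      | zero =>
        exact Abelian.Ext.precomp_mk₀_injective_of_epi ((truncLE q).obj N) ((toTruncLE q).app M)
          (hg := hSM.epi_g) (ha.trans (map_zero pre).symm)
      | succ n =>
        obtain ⟨c, hc⟩ := Abelian.Ext.exists_extClass_comp hSM a ha
        have := orth n
        rw [← hc, Subsingleton.elim c 0, Abelian.Ext.comp_zero]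
        rfl
    · intro b
      have := orth i
      exact Abelian.Ext.contravariant_sequence_exact₂ hSM _ b (Subsingleton.elim _ _)
  rw [← hcomp] at hpost
  exact (Function.Bijective.of_comp_iff' hpre _).mp hpost

end GrMod

/-! ### Free graded modules over A -/

namespace GrMod

variable {K A : Type u} [Field K] [CommRing A] [Algebra K A]
  (𝓐 : ℕ → Submodule K A) [GradedAlgebra 𝓐]

/-- The grading of `A`, extended by `0` to negative degrees. -/
def zgrade : ℤ → Submodule K A
  | Int.ofNat n => 𝓐 n
  | Int.negSucc _ => ⊥

variable {𝓐}

theorem mul_mem_zgrade {i : ℕ} {m m' : ℤ} (h : (i : ℤ) + m = m') {a b : A} (ha : a ∈ 𝓐 i)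
    (hb : b ∈ zgrade 𝓐 m) : a * b ∈ zgrade 𝓐 m' := by
  cases m with
  | ofNat n =>
    obtain rfl : m' = Int.ofNat (i + n) := by rw [← h]; rfl
    exact SetLike.GradedMul.mul_mem ha hb
  | negSucc n =>
    obtain rfl : b = 0 := (Submodule.mem_bot K).mp hb
    rw [mul_zero]
    exact Submodule.zero_mem _

/-- Multiplication by a homogeneous element. -/
def zmul (i : ℕ) {m m' : ℤ} (h : (i : ℤ) + m = m') : 𝓐 i →+ (zgrade 𝓐 m →ₗ[K] zgrade 𝓐 m') where
  toFun a :=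
    { toFun := fun b => ⟨a.1 * b.1, mul_mem_zgrade h a.2 b.2⟩
      map_add' := fun _ _ => Subtype.ext (mul_add _ _ _)
      map_smul' := fun _ _ => Subtype.ext (mul_smul_comm _ _ _) }
  map_zero' := LinearMap.ext fun _ => Subtype.ext (zero_mul _)
  map_add' _ _ := LinearMap.ext fun _ => Subtype.ext (add_mul _ _ _)

open DirectSum in
/-- The free graded `A`-module with generators of degrees `d t`. -/
def freeBase {T : Type u} (d : T → ℤ) : GrMod 𝓐 (RingHom.id K) where
  X j := ⨁ t, zgrade 𝓐 (j - d t)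
  act i j k h :=
    { toFun := fun a => DirectSum.lmap fun t => zmul i (by omega) a
      map_zero' := LinearMap.ext fun x => DFinsupp.ext fun t => by
        rw [DirectSum.lmap_apply, map_zero]; rfl
      map_add' := fun a b => LinearMap.ext fun x => DFinsupp.ext fun t => by
        rw [DirectSum.lmap_apply, map_add]; rfl }
  act_smul i j k h c a x := DFinsupp.ext fun t => Subtype.ext (smul_mul_assoc _ _ _)
  act_one h x := DFinsupp.ext fun t => Subtype.ext (one_mul _)
  act_mul i i' j k l h h' h'' a b x := DFinsupp.ext fun t => Subtype.ext (mul_assoc _ _ _)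

/-- In degree `d t` the coefficient of the generator t has index `d t - d t`, which is 0 only
propositionally. -/
theorem one_mem_zgrade (n : ℤ) : (1 : A) ∈ zgrade 𝓐 (n - n) := by
  rw [sub_self]
  exact (SetLike.GradedOne.one_mem : (1 : A) ∈ 𝓐 0)

open scoped Classical in
/-- The generators of a free module. -/
noncomputable def freeBaseGen {T : Type u} (d : T → ℤ) (t : T) : (freeBase d : GrMod 𝓐 _).X (d t) :=
  DirectSum.lof K T (fun t' => zgrade 𝓐 (d t - d t')) t ⟨1, one_mem_zgrade _⟩

open scoped Classical in
theorem freeBase_act_lof {T : Type u} (d : T → ℤ) (i : ℕ) {j k : ℤ} (h : (i : ℤ) + j = k)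
    (a : 𝓐 i) (t : T) (b : zgrade 𝓐 (j - d t)) :
    (freeBase d : GrMod 𝓐 _).act i h a
        (DirectSum.lof K T (fun t' => zgrade 𝓐 (j - d t')) t b) =
      DirectSum.lof K T (fun t' => zgrade 𝓐 (k - d t')) t (zmul i (by omega) a b) :=
  DirectSum.lmap_lof _ _ _

-- Coefficients of negative degree vanish, and any other homogeneous coefficient is a multiple of 1.
-- This gives both uniqueness of maps out of a free module and its generation by the basis.
open scoped Classical in
theorem freeBase_lof_eq {T : Type u} (d : T → ℤ) {j : ℤ} (t : T) (b : zgrade 𝓐 (j - d t)) :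
    b = 0 ∨ ∃ (n : ℕ) (h : (n : ℤ) + d t = j) (a : 𝓐 n),
      DirectSum.lof K T (fun t' => zgrade 𝓐 (j - d t')) t b =
        (freeBase d).act n h a (freeBaseGen d t) := by
  rcases lt_or_ge (j - d t) 0 with hj | hj
  · left
    obtain ⟨n, hn⟩ := Int.exists_eq_neg_ofNat hj.le
    obtain ⟨n, rfl⟩ : ∃ m, n = m + 1 := ⟨n - 1, by omega⟩
    obtain ⟨b, hb⟩ := b
    rw [hn] at hb
    exact Subtype.ext ((Submodule.mem_bot K).mp hb)
  · right
    obtain ⟨n, hn⟩ := Int.eq_ofNat_of_zero_le hj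
    obtain ⟨b, hb⟩ := b
    have hb' : b ∈ 𝓐 n := by
      have := hb
      rw [hn] at this
      exact this
    refine ⟨n, by omega, ⟨b, hb'⟩, ?_⟩
    rw [freeBaseGen, freeBase_act_lof]
    exact congrArg _ (Subtype.ext (mul_one b).symm)

theorem freeBase_hom_ext {T : Type u} {d : T → ℤ} {N : GrMod 𝓐 (RingHom.id K)}
    {f g : freeBase d ⟶ N}
    (h : ∀ t, f.app _ (freeBaseGen d t) = g.app _ (freeBaseGen d t)) : f = g := by
  classical
  refine Hom.ext (funext fun j => DirectSum.linearMap_ext K fun t => LinearMap.ext fun b => ?_)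
  change f.app j (DirectSum.lof K T (fun t' => zgrade 𝓐 (j - d t')) t b) =
    g.app j (DirectSum.lof K T (fun t' => zgrade 𝓐 (j - d t')) t b)
  obtain rfl | ⟨n, hn, a, e⟩ := freeBase_lof_eq d t b
  · rw [map_zero]
    exact (map_zero (f.app j)).trans (map_zero (g.app j)).symm
  · rw [e, f.comm, g.comm, h]

/-- The map `b ↦ b y` from the homogeneous elements of `A` to a graded module. -/
def zact (N : GrMod 𝓐 (RingHom.id K)) :
    ∀ {m j k : ℤ} (_ : m + j = k) (_ : N.X j), zgrade 𝓐 m →ₗ[K] N.X k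
  | Int.ofNat n, _, _, h, y =>
    { toFun := fun b => N.act n h b y
      map_add' := fun a b => LinearMap.congr_fun (map_add (N.act n h) (show 𝓐 n from a) b) y
      map_smul' := fun c b => N.act_smul n h c b y }
  | Int.negSucc _, _, _, _, _ => 0

theorem zact_zmul (N : GrMod 𝓐 (RingHom.id K)) {i : ℕ} {m m' j k l : ℤ} (h : (i : ℤ) + m = m')
    (hk : m + j = k) (hl : m' + j = l) (h' : (i : ℤ) + k = l) (y : N.X j) (a : 𝓐 i)
    (b : zgrade 𝓐 m) : zact N hl y (zmul i h a b) = N.act i h' a (zact N hk y b) := by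
  cases m with
  | ofNat n =>
    obtain rfl : m' = Int.ofNat (i + n) := by rw [← h]; rfl
    exact N.act_mul i n hk h' hl a b y
  | negSucc n =>
    obtain rfl : b = 0 := Subtype.ext ((Submodule.mem_bot K).mp b.2)
    simp only [map_zero]

/-- The index is a variable with a proof that it is 0, so that it can be `d t - d t`. -/
theorem zact_one (N : GrMod 𝓐 (RingHom.id K)) {m j : ℤ} (hm : m = 0) (h : m + j = j) (y : N.X j)
    (h1 : (1 : A) ∈ zgrade 𝓐 m) : zact N h y ⟨1, h1⟩ = y := by
  subst hm
  exact N.act_one h y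

open scoped Classical in
/-- The homomorphism on a free module with given values on the generators. -/
noncomputable def freeBaseLift {T : Type u} (d : T → ℤ) {N : GrMod 𝓐 (RingHom.id K)}
    (y : ∀ t, N.X (d t)) : freeBase d ⟶ N :=
  Hom.mk (fun j => DirectSum.toModule K T (N.X j) fun t => zact N (by omega) (y t))
    (fun i j k h a x => by
      refine LinearMap.congr_fun (f := (DirectSum.toModule K T (N.X k) fun t =>
          zact N (by omega) (y t)) ∘ₗ (freeBase d).act i h a)
        (g := N.act i h a ∘ₗ DirectSum.toModule K T (N.X j) fun t => zact N (by omega) (y t))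
        (DirectSum.linearMap_ext K fun t => LinearMap.ext fun b => ?_) x
      refine (congrArg (DirectSum.toModule K T (N.X k) fun t => zact N (by omega) (y t))
        (freeBase_act_lof d i h a t b)).trans ?_
      refine (DirectSum.toModule_lof K t _).trans ?_
      refine (zact_zmul N (by omega) (by omega) (by omega) h (y t) a b).trans ?_
      exact congrArg (N.act i h a) (DirectSum.toModule_lof K
        (φ := fun t => zact N (show j - d t + d t = j by omega) (y t)) t b).symm)

theorem freeBaseLift_gen {T : Type u} (d : T → ℤ) {N : GrMod 𝓐 (RingHom.id K)}
    (y : ∀ t, N.X (d t)) (t : T) : (freeBaseLift d y).app _ (freeBaseGen d t) = y t := by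
  classical
  refine (DirectSum.toModule_lof K t _).trans ?_
  exact zact_one N (sub_self _) _ _ _

/-- Epimorphisms are surjective in each degree, so the images of the generators can be lifted one by
one. -/
instance projective_freeBase {T : Type u} (d : T → ℤ) :
    Projective (freeBase d : GrMod 𝓐 (RingHom.id K)) where
  factors {E X} f e _ := by
    choose x hx using fun t => (epi_iff e).mp inferInstance (d t) (f.app _ (freeBaseGen d t))
    exact ⟨freeBaseLift d x, freeBase_hom_ext fun t => by
      rw [comp_app_apply, freeBaseLift_gen, hx]⟩

/-! ### Base change of graded modules -/

section BaseChange

variable {R R' : Type u} [CommRing R] [CommRing R'] {φ : K →+* R}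

/-- Restriction of scalars. -/
def restrictScalars (ψ : R →+* R') (N : GrMod 𝓐 (ψ.comp φ)) : GrMod 𝓐 φ where
  X := N.X
  module j := Module.compHom (N.X j) ψ
  act i j k h :=
    letI := Module.compHom (N.X j) ψ
    letI := Module.compHom (N.X k) ψ
    { toFun := fun a =>
        { toFun := N.act i h a
          map_add' := map_add _
          map_smul' := fun r x => map_smul (N.act i h a) (ψ r) x }
      map_zero' := LinearMap.ext fun x => by
        change N.act i h 0 x = 0
        rw [map_zero]
        rfl
      map_add' := fun a b => LinearMap.ext fun x => by
        change N.act i h (a + b) x = N.act i h a x + N.act i h b x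
        rw [map_add]
        rfl }
  act_smul := N.act_smul
  act_one := N.act_one
  act_mul := N.act_mul

variable {ψ : R →+* R'}

/-- Restriction of scalars of a homomorphism. -/
def restrictScalarsMap {N P : GrMod 𝓐 (ψ.comp φ)} (f : N ⟶ P) :
    restrictScalars ψ N ⟶ restrictScalars ψ P :=
  Hom.mk (fun j =>
    letI := Module.compHom (N.X j) ψ
    letI := Module.compHom (P.X j) ψ
    { toFun := f.app j
      map_add' := map_add _
      map_smul' := fun r x => (f.app j).map_smul (ψ r) (show N.X j from x) })
    f.comm

/-- The map `x ↦ 1 ⊗ x` to the base change. -/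
noncomputable def toBaseChange (M : GrMod 𝓐 φ) (ψ : R →+* R') (j : ℤ) :
    M.X j →+ (M.baseChange ψ).X j :=
  letI := ψ.toAlgebra
  (TensorProduct.mk R R' (M.X j) 1).toAddMonoidHom

theorem toBaseChange_smul (M : GrMod 𝓐 φ) (ψ : R →+* R') (j : ℤ) (r : R) (x : M.X j) :
    toBaseChange M ψ j (r • x) = ψ r • toBaseChange M ψ j x := by
  let := ψ.toAlgebra
  change (1 : R') ⊗ₜ[R] (r • x) = ψ r • ((1 : R') ⊗ₜ[R] x)
  rw [TensorProduct.tmul_smul]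
  exact (algebraMap_smul R' r ((1 : R') ⊗ₜ[R] x)).symm

theorem span_toBaseChange (M : GrMod 𝓐 φ) (ψ : R →+* R') (j : ℤ) :
    Submodule.span R' (Set.range (toBaseChange M ψ j)) = ⊤ := by
  let := ψ.toAlgebra
  rw [eq_top_iff]
  rintro x -
  change R' ⊗[R] M.X j at x
  induction x using TensorProduct.induction_on with
  | zero => exact Submodule.zero_mem _
  | add x y hx hy => exact Submodule.add_mem _ hx hy
  | tmul r x =>
    have : r ⊗ₜ[R] x = r • ((1 : R') ⊗ₜ[R] x) := by
      rw [TensorProduct.smul_tmul', smul_eq_mul, mul_one]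
    rw [this]
    exact Submodule.smul_mem _ _ (Submodule.subset_span ⟨x, rfl⟩)

theorem baseChange_hom_ext {M : GrMod 𝓐 φ} {N : GrMod 𝓐 (ψ.comp φ)} {f g : M.baseChange ψ ⟶ N}
    (h : ∀ j x, f.app j (toBaseChange M ψ j x) = g.app j (toBaseChange M ψ j x)) : f = g :=
  Hom.ext (funext fun j => LinearMap.ext_on (span_toBaseChange M ψ j) (by
    rintro _ ⟨x, rfl⟩
    exact h j x))

/-- The homomorphism on a base change which extends a given homomorphism. -/
noncomputable def baseChangeLift {M : GrMod 𝓐 φ} {N : GrMod 𝓐 (ψ.comp φ)}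
    (g : M ⟶ restrictScalars ψ N) : M.baseChange ψ ⟶ N :=
  letI := ψ.toAlgebra
  letI (j : ℤ) : Module R (N.X j) := Module.compHom (N.X j) ψ
  haveI (j : ℤ) : IsScalarTower R R' (N.X j) := ⟨fun r s x => mul_smul (ψ r) s x⟩
  let l (j : ℤ) : M.X j →ₗ[R] N.X j := g.app j
  Hom.mk (fun j => LinearMap.liftBaseChange R' (l j))
    (fun i j k h a x => by
      change R' ⊗[R] M.X j at x
      induction x using TensorProduct.induction_on with
      | zero => exact (map_zero _).trans (map_zero (N.act i h a)).symm
      | add x y hx hy =>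
        exact (map_add ((l k).liftBaseChange R' ∘ₗ (M.baseChange ψ).act i h a) x y).trans
          ((congrArg₂ (· + ·) hx hy).trans
            (map_add (N.act i h a ∘ₗ (l j).liftBaseChange R') x y).symm)
      | tmul r x =>
        change r • l k (M.act i h a x) = N.act i h a (r • l j x)
        rw [map_smul]
        exact congrArg (r • ·) (g.comm i h a x))

theorem baseChangeLift_apply {M : GrMod 𝓐 φ} {N : GrMod 𝓐 (ψ.comp φ)}
    (g : M ⟶ restrictScalars ψ N) (j : ℤ) (x : M.X j) :
    (baseChangeLift g).app j (toBaseChange M ψ j x) = g.app j x :=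
  one_smul R' (show N.X j from g.app j x)

/-- The restriction of a homomorphism on a base change. -/
noncomputable def baseChangeUnlift {M : GrMod 𝓐 φ} {N : GrMod 𝓐 (ψ.comp φ)}
    (f : M.baseChange ψ ⟶ N) : M ⟶ restrictScalars ψ N :=
  Hom.mk (fun j =>
    letI := Module.compHom (N.X j) ψ
    { toFun := fun x => f.app j (toBaseChange M ψ j x)
      map_add' := fun x y => by rw [map_add, map_add]; rfl
      map_smul' := fun r x => by
        rw [toBaseChange_smul, map_smul]
        rfl })
    (fun i j k h a x => f.comm i h a (toBaseChange M ψ j x))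

/-- Base change is left adjoint to restriction of scalars, which preserves degreewise surjections.
-/
instance projective_baseChange (P : GrMod 𝓐 φ) [Projective P] : Projective (P.baseChange ψ) where
  factors {E X} f e _ := by
    have : Epi (restrictScalarsMap e) := (epi_iff _).mpr fun j => (epi_iff e).mp inferInstance j
    refine ⟨baseChangeLift (Projective.factorThru (baseChangeUnlift f) (restrictScalarsMap e)),
      baseChange_hom_ext fun j x => ?_⟩
    rw [comp_app_apply, baseChangeLift_apply]
    exact LinearMap.congr_fun (congrArg (fun t : P ⟶ restrictScalars ψ X => t.app j)
      (Projective.factorThru_comp (baseChangeUnlift f) (restrictScalarsMap e))) x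

end BaseChange

end GrMod

/-! ### The total module over R ⊗ A, and noetherianity -/

namespace GrMod

variable {K A R : Type u} [Field K] [CommRing A] [Algebra K A] [CommRing R]
  {𝓐 : ℕ → Submodule K A} [GradedAlgebra 𝓐] {φ : K →+* R}

/-- The direct sum of the components of a graded module. -/
def Total (M : GrMod 𝓐 φ) : Type u := DirectSum ℤ M.X

namespace Total

variable (M : GrMod 𝓐 φ)

noncomputable instance : AddCommGroup M.Total := inferInstanceAs (AddCommGroup (DirectSum ℤ M.X))
noncomputable instance : Module R M.Total := inferInstanceAs (Module R (DirectSum ℤ M.X))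

/-- The inclusion of a component. -/
noncomputable def of (j : ℤ) : M.X j →ₗ[R] M.Total := DirectSum.lof R ℤ M.X j

/-- The projection to a component. -/
noncomputable def proj (j : ℤ) : M.Total →ₗ[R] M.X j := DirectSum.component R ℤ M.X j

variable {M}

theorem proj_of_same (j : ℤ) (x : M.X j) : proj M j (of M j x) = x :=
  DirectSum.component.lof_self R (M := M.X) j x

theorem proj_of_ne {j k : ℤ} (h : j ≠ k) (x : M.X j) : proj M k (of M j x) = 0 :=
  DirectSum.of_eq_of_ne j k x h.symm

theorem hom_ext {N : Type*} [AddCommGroup N] [Module R N] {f g : M.Total →ₗ[R] N}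
    (h : ∀ j x, f (of M j x) = g (of M j x)) : f = g :=
  DirectSum.linearMap_ext R fun j => LinearMap.ext (h j)

theorem exists_eq_sum (w : M.Total) : ∃ s : Finset ℤ, w = ∑ j ∈ s, of M j (proj M j w) := by
  classical
  exact ⟨_, (DirectSum.sum_support_of w).symm⟩

/-- The action of a homogeneous element. -/
noncomputable def actHom (i : ℕ) : 𝓐 i →+ Module.End R M.Total where
  toFun a := DirectSum.toModule R ℤ M.Total fun _ => of M _ ∘ₗ M.act i rfl a
  map_zero' := hom_ext fun j x => by
    refine (DirectSum.toModule_lof R j x).trans ?_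
    rw [map_zero]
    exact map_zero (of M _)
  map_add' a b := hom_ext fun j x => by
    refine (DirectSum.toModule_lof R j x).trans ?_
    refine Eq.trans ?_ (congrArg₂ (· + ·)
      (DirectSum.toModule_lof R (φ := fun _ => of M _ ∘ₗ M.act i rfl a) j x)
      (DirectSum.toModule_lof R (φ := fun _ => of M _ ∘ₗ M.act i rfl b) j x)).symm
    rw [map_add]
    exact map_add (of M _) _ _

theorem actHom_of (i : ℕ) {j k : ℤ} (h : (i : ℤ) + j = k) (a : 𝓐 i) (x : M.X j) :
    actHom i a (of M j x) = of M k (M.act i h a x) := by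
  subst h
  exact DirectSum.toModule_lof R j x

theorem actHom_one (M : GrMod 𝓐 φ) :
    actHom (M := M) 0 ⟨1, SetLike.GradedOne.one_mem⟩ = 1 := hom_ext fun j x => by
  have h : ((0 : ℕ) : ℤ) + j = j := by simp
  exact (actHom_of 0 h _ x).trans (congrArg _ (M.act_one h x))

theorem actHom_mul (M : GrMod 𝓐 φ) {i i' : ℕ} (a : 𝓐 i) (b : 𝓐 i') :
    actHom (M := M) (i + i') ⟨a.1 * b.1, SetLike.GradedMul.mul_mem a.2 b.2⟩ =
      actHom i a * actHom i' b :=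
  hom_ext fun j x => by
    have h : (i : ℤ) + (i' + j) = (i + i' : ℕ) + j := by push_cast; ring
    refine (actHom_of (i + i') rfl _ x).trans ?_
    refine Eq.trans ?_ (congrArg (actHom i a) (actHom_of i' rfl b x)).symm
    refine Eq.trans ?_ (actHom_of i h a _).symm
    exact congrArg _ (M.act_mul i i' _ _ _ a b x)

/-- The action of `A`. -/
noncomputable def actRingHom (M : GrMod 𝓐 φ) : A →+* Module.End R M.Total :=
  (DirectSum.toSemiring (A := fun i => 𝓐 i) actHom (actHom_one M) (actHom_mul M)).comp
    (DirectSum.decomposeRingEquiv 𝓐).toRingHom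

theorem actRingHom_coe {i : ℕ} (a : 𝓐 i) : actRingHom M a.1 = actHom i a := by
  change DirectSum.toSemiring _ (actHom_one M) (actHom_mul M) (DirectSum.decompose 𝓐 a.1) = _
  rw [DirectSum.decompose_coe, DirectSum.toSemiring_of]

noncomputable instance : Module A M.Total := Module.compHom M.Total (actRingHom M)

theorem smul_def (a : A) (w : M.Total) : a • w = actRingHom M a w := rfl

theorem smul_of (i : ℕ) {j k : ℤ} (h : (i : ℤ) + j = k) (a : 𝓐 i) (x : M.X j) :
    a.1 • of M j x = of M k (M.act i h a x) := by
  rw [smul_def, actRingHom_coe, actHom_of i h]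

instance : SMulCommClass R A M.Total := ⟨fun r a w => (map_smul (actRingHom M a) r w).symm⟩

noncomputable instance : Module K M.Total := Module.compHom M.Total φ

theorem smul_base (c : K) (w : M.Total) : c • w = φ c • w := rfl

/-- With the commuting actions of `R` and `A`, this compatibility is what lets `R ⊗[K] A` act on the
total module. It is checked on homogeneous elements of `A`. -/
instance : IsScalarTower K A M.Total := ⟨fun c a w => by
  rw [smul_base]
  induction a using DirectSum.Decomposition.inductionOn 𝓐 with
  | zero => rw [smul_zero, zero_smul, smul_zero]
  | add a b ha hb => rw [smul_add, add_smul, ha, hb, add_smul, smul_add]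
  | @homogeneous i a =>
    rw [smul_def, smul_def, ← Submodule.coe_smul, actRingHom_coe, actRingHom_coe,
      ← LinearMap.smul_apply]
    refine LinearMap.congr_fun (hom_ext fun j x => ?_) w
    rw [LinearMap.smul_apply, actHom_of i rfl, actHom_of i rfl, M.act_smul, map_smul]⟩

end Total

variable (M : GrMod 𝓐 φ)

/-- The graded submodule generated by homogeneous elements. -/
def genSub {M : GrMod 𝓐 φ} {T : Type*} (d : T → ℤ) (x : ∀ t, M.X (d t)) : Sub M where
  N j := Submodule.span R {y | ∃ (t : T) (i : ℕ) (h : (i : ℤ) + d t = j) (a : 𝓐 i),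
    y = M.act i h a (x t)}
  act_mem i j k h a y hy := by
    induction hy using Submodule.span_induction with
    | mem y hy =>
      obtain ⟨t, i', h', b, rfl⟩ := hy
      have h'' : ((i + i' : ℕ) : ℤ) + d t = k := by push_cast; omega
      rw [← M.act_mul i i' h' h h'']
      exact Submodule.subset_span ⟨t, _, _, _, rfl⟩
    | zero => rw [map_zero]; exact Submodule.zero_mem _
    | add y z _ _ hy hz => rw [map_add]; exact Submodule.add_mem _ hy hz
    | smul r y _ hy => rw [map_smul]; exact Submodule.smul_mem _ _ hy

theorem mem_genSub {M : GrMod 𝓐 φ} {T : Type*} (d : T → ℤ) (x : ∀ t, M.X (d t)) (t : T) :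
    x t ∈ (genSub d x).N (d t) :=
  Submodule.subset_span ⟨t, 0, by simp, ⟨1, SetLike.GradedOne.one_mem⟩, (M.act_one _ _).symm⟩

theorem genSub_le {M : GrMod 𝓐 φ} {T : Type*} {d : T → ℤ} {x : ∀ t, M.X (d t)} {S : Sub M}
    (h : ∀ t, x t ∈ S.N (d t)) (j : ℤ) : (genSub d x).N j ≤ S.N j := by
  refine Submodule.span_le.mpr ?_
  rintro _ ⟨t, i, hi, a, rfl⟩
  exact S.act_mem i hi a _ (h t)

theorem finGen_of_finite {M : GrMod 𝓐 φ} {T : Type*} [Finite T] (d : T → ℤ) (x : ∀ t, M.X (d t))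
    (h : ∀ j, (genSub d x).N j = ⊤) : M.FinGen := by
  obtain ⟨n, ⟨e⟩⟩ := Finite.exists_equiv_fin T
  refine ⟨n, fun t => d (e.symm t), fun t => x (e.symm t), fun j => ?_⟩
  rw [← h j]
  refine congrArg (Submodule.span R) (Set.ext fun y => ?_)
  constructor
  · rintro ⟨t, h⟩
    exact ⟨e.symm t, h⟩
  · rintro ⟨t, h⟩
    obtain ⟨t, rfl⟩ := e.symm.surjective t
    exact ⟨t, h⟩

section Noetherian

attribute [local instance] TensorProduct.Algebra.module

section

variable [Algebra K R]

/-- The submodule of the total module which corresponds to a graded submodule. -/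
noncomputable def Sub.total {M : GrMod 𝓐 φ} [IsScalarTower K R M.Total] (S : Sub M) :
    Submodule (R ⊗[K] A) M.Total where
  carrier := {w | ∀ j, Total.proj M j w ∈ S.N j}
  zero_mem' j := by rw [map_zero]; exact Submodule.zero_mem _
  add_mem' hv hw j := by rw [map_add]; exact Submodule.add_mem _ (hv j) (hw j)
  smul_mem' b w hw := by
    -- A homogeneous element of degree i moves the component of degree k to degree i + k only.
    have key (a : A) (j : ℤ) : Total.proj M j (a • w) ∈ S.N j := by
      induction a using DirectSum.Decomposition.inductionOn 𝓐 with
      | zero => rw [zero_smul, map_zero]; exact Submodule.zero_mem _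
      | add a b ha hb => rw [add_smul, map_add]; exact Submodule.add_mem _ ha hb
      | @homogeneous i a =>
        obtain ⟨s, hs⟩ := Total.exists_eq_sum w
        rw [hs, Finset.smul_sum, map_sum]
        refine Submodule.sum_mem _ fun k _ => ?_
        rw [Total.smul_of i rfl]
        by_cases hk : (i : ℤ) + k = j
        · subst hk
          rw [Total.proj_of_same]
          exact S.act_mem i rfl a _ (hw k)
        · rw [Total.proj_of_ne hk]
          exact Submodule.zero_mem _
    induction b using TensorProduct.induction_on with
    | zero => intro j; rw [zero_smul, map_zero]; exact Submodule.zero_mem _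
    | add b c hb hc => intro j; rw [add_smul, map_add]; exact Submodule.add_mem _ (hb j) (hc j)
    | tmul r a =>
      intro j
      rw [TensorProduct.Algebra.smul_def, map_smul]
      exact Submodule.smul_mem _ _ (key a j)

theorem Sub.of_mem_total {M : GrMod 𝓐 φ} [IsScalarTower K R M.Total] {S : Sub M} {j : ℤ}
    {x : M.X j} (hx : x ∈ S.N j) : Total.of M j x ∈ S.total := fun k => by
  by_cases h : j = k
  · subst h
    rwa [Total.proj_of_same]
  · rw [Total.proj_of_ne h]
    exact Submodule.zero_mem _

/-- A graded submodule whose total module is finitely generated is generated by finitely many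
homogeneous elements. -/
theorem Sub.exists_genSub_eq {M : GrMod 𝓐 φ} [IsScalarTower K R M.Total] (S : Sub M)
    (hS : S.total.FG) : ∃ (T : Type u) (_ : Finite T) (d : T → ℤ) (x : ∀ t, M.X (d t)),
      (∀ t, x t ∈ S.N (d t)) ∧ ∀ j, S.N j ≤ (genSub d x).N j := by
  obtain ⟨G, hG⟩ := hS
  choose s hs using fun w : M.Total => Total.exists_eq_sum w
  have hGS : ∀ w ∈ G, w ∈ S.total := fun w hw => hG ▸ Submodule.subset_span hw
  -- The new generators are the homogeneous components of the finitely many given ones; they lie in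
  -- S because S is graded.
  refine ⟨Σ w : G, ULift (s w), inferInstance, fun t => t.2.down.1,
    fun t => Total.proj M _ t.1.1, fun t => hGS _ t.1.2 _, fun j y hy => ?_⟩
  set S' := genSub (fun t : Σ w : G, ULift (s w) => (t.2.down.1 : ℤ))
    (fun t => Total.proj M _ t.1.1)
  have hle : S.total ≤ S'.total := by
    rw [← hG, Submodule.span_le]
    intro w hw
    rw [hs w]
    refine Submodule.sum_mem _ fun k hk => Sub.of_mem_total ?_
    exact mem_genSub (fun t : Σ w : G, ULift (s w) => (t.2.down.1 : ℤ))
      (fun t => Total.proj M _ t.1.1) ⟨⟨w, hw⟩, ⟨⟨k, hk⟩⟩⟩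
  have := hle (Sub.of_mem_total hy) j
  rwa [Total.proj_of_same] at this

theorem Total.finite {M : GrMod 𝓐 φ} [IsScalarTower K R M.Total] (hM : M.FinGen) :
    Module.Finite (R ⊗[K] A) M.Total := by
  obtain ⟨n, d, x, hx⟩ := hM
  let P : Submodule (R ⊗[K] A) M.Total :=
    Submodule.span _ (Set.range fun t => Total.of M (d t) (x t))
  have hsmul (r : R) (a : A) (w : M.Total) (hw : w ∈ P) : r • a • w ∈ P := by
    rw [← TensorProduct.Algebra.smul_def (R := K)]
    exact P.smul_mem _ hw
  have key (j : ℤ) (y : M.X j) : Total.of M j y ∈ P := by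
    have hy : y ∈ (⊤ : Submodule R (M.X j)) := trivial
    rw [← hx j] at hy
    induction hy using Submodule.span_induction with
    | mem y hy =>
      obtain ⟨t, i, h, a, rfl⟩ := hy
      rw [← Total.smul_of i h, ← one_smul R (a.1 • _)]
      exact hsmul _ _ _ (Submodule.subset_span ⟨t, rfl⟩)
    | zero => rw [map_zero]; exact P.zero_mem
    | add y z _ _ hy hz => rw [map_add]; exact P.add_mem hy hz
    | smul r y _ hy =>
      rw [map_smul, ← one_smul A (Total.of M j y)]
      exact hsmul _ _ _ hy
  have hP : P = ⊤ := by
    rw [eq_top_iff]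
    rintro w -
    obtain ⟨s, hs⟩ := Total.exists_eq_sum w
    rw [hs]
    exact P.sum_mem fun j _ => key j _
  exact ⟨⟨(Set.finite_range fun t => Total.of M (d t) (x t)).toFinset, by
    rw [Set.Finite.coe_toFinset]; exact hP⟩⟩

end

/-- Graded submodules of finitely generated graded modules are finitely generated. -/
theorem FinGen.sub [IsNoetherianRing R] [Algebra.FiniteType K A] {M : GrMod 𝓐 φ} (hM : M.FinGen)
    (S : Sub M) : S.toGrMod.FinGen := by
  let := φ.toAlgebra
  have : IsScalarTower K R M.Total := ⟨fun c r w => mul_smul (φ c) r w⟩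
  -- Hilbert's basis theorem: `R ⊗[K] A` is an algebra of finite type over the noetherian ring `R`.
  have : IsNoetherianRing (R ⊗[K] A) := Algebra.FiniteType.isNoetherianRing R _
  have := Total.finite hM
  obtain ⟨T, _, d, x, hx, hle⟩ := S.exists_genSub_eq (IsNoetherian.noetherian S.total)
  refine finGen_of_finite (M := S.toGrMod) d (fun t => ⟨x t, hx t⟩) fun j => ?_
  rw [eq_top_iff]
  rintro ⟨y, hy⟩ -
  -- The generation was obtained inside M; the inclusion of S commutes with the actions, which
  -- carries it over to S as a module in its own right.
  have h : (genSub d x).N j ≤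
      ((genSub (M := S.toGrMod) d fun t => ⟨x t, hx t⟩).N j).map (S.incl.app j) := by
    refine Submodule.span_le.mpr ?_
    rintro _ ⟨t, i, hi, a, rfl⟩
    exact ⟨_, Submodule.subset_span ⟨t, i, hi, a, rfl⟩, rfl⟩
  obtain ⟨z, hz, e⟩ := h (hle j hy)
  rwa [← (Subtype.ext e : z = ⟨y, hy⟩)]

end Noetherian

end GrMod

/-! ### Flat syzygies, and vanishing of Ext uniformly under base change -/

/-- The kernel of a surjection between flat modules is flat. -/
theorem Module.Flat.ker_of_surjective {R M N : Type*} [CommRing R] [AddCommGroup M] [Module R M]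
    [AddCommGroup N] [Module R N] [Module.Flat R M] [Module.Flat R N] (f : M →ₗ[R] N)
    (hf : Function.Surjective f) : Module.Flat R (LinearMap.ker f) := by
  rw [Module.Flat.iff_rTensor_injective']
  intro I
  -- The composite is also I ⊗ ker f → I ⊗ M → R ⊗ M; the first map is injective because N is flat,
  -- the second because M is flat.
  have h : Function.Injective ((LinearMap.ker f).subtype.lTensor R ∘
      I.subtype.rTensor (LinearMap.ker f)) := by
    rw [← LinearMap.coe_comp, LinearMap.lTensor_comp_rTensor, ← LinearMap.rTensor_comp_lTensor,
      LinearMap.coe_comp]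
    exact (Module.Flat.rTensor_preserves_injective_linearMap _ I.injective_subtype).comp
      (LinearMap.lTensor_injective_of_exact_of_flat f hf _ (LinearMap.ker f).subtype_injective
        (LinearMap.exact_subtype_ker_map f) I)
  exact h.of_comp

namespace GrMod

variable {K A R R' : Type u} [Field K] [CommRing A] [Algebra K A] [CommRing R] [CommRing R']
  {𝓐 : ℕ → Submodule K A} [GradedAlgebra 𝓐] {φ : K →+* R}

section Free

variable {T : Type u}

/-- The free graded module over `R ⊗ A` with generators of degrees `d t`. -/
noncomputable def free (φ : K →+* R) (d : T → ℤ) : GrMod 𝓐 φ :=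
  (freeBase d : GrMod 𝓐 (RingHom.id K)).baseChange φ

instance projective_free (d : T → ℤ) : Projective (free φ d : GrMod 𝓐 φ) :=
  projective_baseChange (ψ := φ) (freeBase d : GrMod 𝓐 (RingHom.id K))

/-- The components are base changes of vector spaces over `K`. -/
instance flat_free (d : T → ℤ) (j : ℤ) : Module.Flat R ((free φ d : GrMod 𝓐 φ).X j) :=
  letI := φ.toAlgebra
  inferInstanceAs (Module.Flat R (R ⊗[K] (freeBase d : GrMod 𝓐 (RingHom.id K)).X j))

/-- The generators of a free module. -/
noncomputable def freeGen (φ : K →+* R) (d : T → ℤ) (t : T) : (free φ d : GrMod 𝓐 φ).X (d t) :=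
  toBaseChange (freeBase d : GrMod 𝓐 (RingHom.id K)) φ (d t) (freeBaseGen d t)

/-- The homomorphism on a free module with given values on the generators. -/
noncomputable def freeLift (d : T → ℤ) {N : GrMod 𝓐 φ} (y : ∀ t, N.X (d t)) : free φ d ⟶ N :=
  -- Base change along `φ` produces the scalars `φ.comp (RingHom.id K)`, which agree with `φ` by
  -- definition.
  let N' : GrMod 𝓐 (φ.comp (RingHom.id K)) := N
  let f : (freeBase d : GrMod 𝓐 (RingHom.id K)).baseChange φ ⟶ N' :=
    baseChangeLift (freeBaseLift d y)
  f

theorem freeLift_gen (d : T → ℤ) {N : GrMod 𝓐 φ} (y : ∀ t, N.X (d t)) (t : T) :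
    (freeLift d y).app (d t) (freeGen φ d t) = y t := by
  let N' : GrMod 𝓐 (φ.comp (RingHom.id K)) := N
  exact (baseChangeLift_apply (N := N') (freeBaseLift d y) (d t) (freeBaseGen d t)).trans
    (freeBaseLift_gen d (N := restrictScalars φ N') y t)

theorem freeLift_surjective (d : T → ℤ) {N : GrMod 𝓐 φ} (y : ∀ t, N.X (d t))
    (h : ∀ j, (genSub d y).N j = ⊤) (j : ℤ) : Function.Surjective ((freeLift d y).app j) := by
  intro x
  have hx : x ∈ (genSub d y).N j := by rw [h j]; trivial
  exact genSub_le (S := range (freeLift d y)) (fun t => ⟨_, freeLift_gen d y t⟩) j hx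

end Free

/-- The free module with one generator for every homogeneous element of M maps onto M. -/
instance : EnoughProjectives (GrMod 𝓐 φ) where
  presentation M := by
    let d : (Σ j, M.X j) → ℤ := Sigma.fst
    exact ⟨{
      p := free φ d
      f := freeLift d fun t => t.2
      epi := (epi_iff _).mpr fun j x => ⟨_, freeLift_gen d (fun t => t.2) ⟨j, x⟩⟩ }⟩

/-- A finitely generated graded module is a quotient of a finitely generated, free one. -/
theorem FinGen.exists_free {M : GrMod 𝓐 φ} (hM : M.FinGen) :
    ∃ (T : Type u) (_ : Finite T) (d : T → ℤ) (f : free φ d ⟶ M),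
      ∀ j, Function.Surjective (f.app j) := by
  obtain ⟨n, d, x, h⟩ := hM
  refine ⟨ULift (Fin n), inferInstance, fun t => d t.down, freeLift _ fun t => x t.down,
    freeLift_surjective _ _ fun j => ?_⟩
  rw [← h j]
  refine congrArg (Submodule.span R) (Set.ext fun y => ?_)
  exact Equiv.ulift.exists_congr_left

theorem genSub_freeGen {T : Type u} (d : T → ℤ) (j : ℤ) :
    (genSub (M := (free φ d : GrMod 𝓐 φ)) d (freeGen φ d)).N j = ⊤ := by
  classical
  let P := (genSub (M := (free φ d : GrMod 𝓐 φ)) d (freeGen φ d)).N j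
  let g : (DirectSum T fun t => zgrade 𝓐 (j - d t)) →+ (free φ d : GrMod 𝓐 φ).X j :=
    toBaseChange (freeBase d : GrMod 𝓐 (RingHom.id K)) φ j
  have key (x) : g x ∈ P := by
    induction x using DirectSum.induction_on with
    | zero => rw [map_zero]; exact P.zero_mem
    | add x y hx hy => rw [map_add]; exact P.add_mem hx hy
    | of t b =>
      obtain rfl | ⟨n, hn, a, e⟩ := freeBase_lof_eq d t b
      · rw [map_zero, map_zero]; exact P.zero_mem
      · have : (free φ d).act n hn a (freeGen φ d t) ∈ P :=
          Submodule.subset_span ⟨t, n, hn, a, rfl⟩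
        exact (congrArg (· ∈ P) (congrArg g e)).mpr this
  have h := span_toBaseChange (freeBase d : GrMod 𝓐 (RingHom.id K)) φ j
  change Submodule.span R (Set.range g) = ⊤ at h
  rw [eq_top_iff, ← h, Submodule.span_le]
  rintro _ ⟨x, rfl⟩
  exact key x

theorem finGen_free {T : Type u} [Finite T] (d : T → ℤ) : (free φ d : GrMod 𝓐 φ).FinGen :=
  finGen_of_finite d _ (genSub_freeGen d)

/-- The base change of a homomorphism. -/
noncomputable def baseChangeMap {M N : GrMod 𝓐 φ} (ψ : R →+* R') (f : M ⟶ N) :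
    M.baseChange ψ ⟶ N.baseChange ψ :=
  letI := ψ.toAlgebra
  Hom.mk (fun j => (f.app j).baseChange R') (fun i j k h a x => by
    refine LinearMap.congr_fun (f := (f.app k).baseChange R' ∘ₗ (M.act i h a).baseChange R')
      (g := (N.act i h a).baseChange R' ∘ₗ (f.app j).baseChange R') ?_ x
    rw [← LinearMap.baseChange_comp, ← LinearMap.baseChange_comp]
    exact congrArg _ (LinearMap.ext fun y => f.comm i h a y))

/-- Base change preserves the short exact sequence of a surjection to a flat module. -/
theorem baseChange_ker_shortExact {M N : GrMod 𝓐 φ} (ψ : R →+* R') (f : M ⟶ N)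
    (hf : ∀ j, Function.Surjective (f.app j)) [∀ j, Module.Flat R (N.X j)] :
    ∃ h, (ShortComplex.mk (baseChangeMap ψ (ker f).incl) (baseChangeMap ψ f) h).ShortExact := by
  let := ψ.toAlgebra
  have hex (j : ℤ) := lTensor_exact R' (LinearMap.exact_subtype_ker_map (f.app j)) (hf j)
  refine ⟨hom_ext fun j x => (hex j _).mpr ⟨x, rfl⟩, ?_⟩
  exact
    { exact := (exact_iff _).mpr fun j x hx => (hex j x).mp hx
      mono_f := (mono_iff _).mpr fun j => LinearMap.lTensor_injective_of_exact_of_flat (f.app j)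
        (hf j) _ (LinearMap.ker (f.app j)).subtype_injective
        (LinearMap.exact_subtype_ker_map (f.app j)) R'
      epi_g := (epi_iff _).mpr fun j => LinearMap.lTensor_surjective R' (hf j) }

/-- The elements 1 ⊗ x t generate the base change and can only go to 0. The degrees involved are
those of M, whatever `ψ` is; this is the source of uniformity. -/
theorem baseChange_hom_eq_zero {M : GrMod 𝓐 φ} {ψ : R →+* R'} {N : GrMod 𝓐 (ψ.comp φ)}
    {T : Type*} {d : T → ℤ} {x : ∀ t, M.X (d t)} (hx : ∀ j, (genSub d x).N j = ⊤)
    (hN : ∀ t, Subsingleton (N.X (d t))) (f : M.baseChange ψ ⟶ N) : f = 0 := by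
  refine baseChange_hom_ext fun j y => ?_
  have hy : y ∈ (genSub d x).N j := by rw [hx j]; trivial
  have := genSub_le (S := ker (baseChangeUnlift f)) (fun t => (hN t).elim _ _) j hy
  exact this

/-- For a finitely generated graded module `M` which is flat over a noetherian base, the groups
`Ext^n(M', N)` vanish if `M'` is any base change of `M` and `N` lives in large degrees. -/
theorem FinGen.exists_ext_baseChange_subsingleton [IsNoetherianRing R] [Algebra.FiniteType K A]
    (n : ℕ) : ∀ {M : GrMod 𝓐 φ}, M.FinGen → (∀ j, Module.Flat R (M.X j)) →
      ∃ q : ℤ, ∀ (R' : Type u) [CommRing R'] (ψ : R →+* R') (N : GrMod 𝓐 (ψ.comp φ)),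
        (∀ j ≤ q, Subsingleton (N.X j)) → Subsingleton (Abelian.Ext (M.baseChange ψ) N n) := by
  induction n with
  | zero =>
    intro M hM _
    obtain ⟨m, d, x, hx⟩ := hM
    -- q bounds the degrees of the generators of M.
    obtain ⟨q, hq⟩ := Set.Finite.bddAbove (Set.finite_range d)
    refine ⟨q, fun R' _ ψ N hN => ext_zero_subsingleton_of_hom fun f =>
      baseChange_hom_eq_zero (d := d) (x := x) hx (fun t => hN _ (hq ⟨t, rfl⟩)) f⟩
  | succ n ih =>
    intro M hM _
    obtain ⟨T, _, d, f, hf⟩ := hM.exists_free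
    -- The first syzygy is again finitely generated and flat, and by dimension shifting its bound in
    -- degree n serves M in degree n + 1.
    obtain ⟨q, hq⟩ := ih ((finGen_free d).sub (ker f)) fun j =>
      Module.Flat.ker_of_surjective (f.app j) (hf j)
    refine ⟨q, fun R' _ ψ N hN => subsingleton_of_forall_eq 0 fun e => ?_⟩
    obtain ⟨_, hS⟩ := baseChange_ker_shortExact ψ f hf
    obtain ⟨e', rfl⟩ := Abelian.Ext.exists_extClass_comp hS e
      (Abelian.Ext.eq_zero_of_projective (P := (free φ d).baseChange ψ) _)
    have := hq R' ψ N hN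
    exact (congrArg (fun e' => hS.extClass.comp e' (add_comm 1 n)) (Subsingleton.elim e' 0)).trans
      (Abelian.Ext.comp_zero _ _ _ _ _)

/-- Transport along an equality of the scalars. -/
def congrScalars (M : GrMod 𝓐 φ) {φ' : K →+* R} (h : φ = φ') : GrMod 𝓐 φ' where
  X := M.X
  act := M.act
  act_smul i _ _ hi c a x := by rw [← h]; exact M.act_smul i hi c a x
  act_one := M.act_one
  act_mul := M.act_mul

/-- The truncation maps on `Ext` are bijective in large degrees, uniformly for all base changes of
a finitely generated, flat graded module over a noetherian base. -/
theorem FinGen.exists_extTrunc_bijective [IsNoetherianRing R] [Algebra.FiniteType K A]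
    {M : GrMod 𝓐 φ} (hM : M.FinGen) [∀ j, Module.Flat R (M.X j)] (i : ℕ) :
    ∃ q₀ : ℤ, ∀ (R' : Type u) [CommRing R'] (ψ : R →+* R') (φ' : K →+* R') (h : ψ.comp φ = φ')
      (M' N : GrMod 𝓐 φ'), Nonempty (M' ≅ (M.baseChange ψ).congrScalars h) →
      ∀ q ≥ q₀, Function.Bijective (extTrunc M' N i q) := by
  obtain ⟨q₁, h₁⟩ := hM.exists_ext_baseChange_subsingleton i inferInstance
  obtain ⟨q₂, h₂⟩ := hM.exists_ext_baseChange_subsingleton (i + 1) inferInstance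
  refine ⟨max q₁ q₂, fun R' _ ψ φ' h M' N ⟨e⟩ q hq => ?_⟩
  subst h
  -- Vanishing of Ext passes along the isomorphism of M' with the base change.
  have key (n : ℕ) (P : GrMod 𝓐 (ψ.comp φ))
      (hP : Subsingleton (Abelian.Ext (M.baseChange ψ) P n)) :
      Subsingleton (Abelian.Ext M' P n) := by
    refine subsingleton_of_forall_eq 0 fun x => ?_
    rw [← Abelian.Ext.mk₀_id_comp x, ← e.hom_inv_id, ← Abelian.Ext.mk₀_comp_mk₀_assoc]
    exact (congrArg (fun y => (Abelian.Ext.mk₀ e.hom).comp y (zero_add n))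
      (hP.elim _ 0)).trans (Abelian.Ext.comp_zero _ _ _ _ _)
  exact extTrunc_bijective M' N i q
    (key i _ (h₁ R' ψ _ fun j hj => N.geSub_subsingleton (by omega)))
    (key (i + 1) _ (h₂ R' ψ _ fun j hj => N.geSub_subsingleton (by omega)))

end GrMod

/-! ### Base change as a property of semilinear maps -/

section SemilinearBaseChange

variable {R R' M N : Type*} [CommRing R] [CommRing R'] [AddCommGroup M] [AddCommGroup N]
  [Module R M] [Module R' N]

/-- A semilinear map over `ψ : R → R'` that exhibits the target as the base change of the source
along `ψ`. -/
def SemilinearBaseChange (ψ : R →+* R') (g : M →ₛₗ[ψ] N) : Prop :=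
  letI := ψ.toAlgebra
  letI : Module R N := Module.compHom N ψ
  haveI : IsScalarTower R R' N := ⟨fun r s x => mul_smul (ψ r) s x⟩
  IsBaseChange R' ({ toFun := g, map_add' := g.map_add, map_smul' := g.map_smulₛₗ } : M →ₗ[R] N)

/-- `SemilinearBaseChange` uses the structures induced by `ψ`; other instances with the same scalar
action are equal to these. -/
theorem IsBaseChange.semilinear [Algebra R R'] [Module R N] [IsScalarTower R R' N]
    {g : M →ₗ[R] N} (hg : IsBaseChange R' g) {ψ : R →+* R'} (hψ : ψ = algebraMap R R')
    (g' : M →ₛₗ[ψ] N) (h : ∀ x, g' x = g x) : SemilinearBaseChange ψ g' := by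
  subst hψ
  unfold SemilinearBaseChange
  have e1 : (algebraMap R R').toAlgebra = ‹Algebra R R'› := Algebra.algebra_ext _ _ fun _ => rfl
  have e2 : Module.compHom N (algebraMap R R') = ‹Module R N› :=
    Module.ext' _ _ fun r x => (algebraMap_smul R' r x)
  convert hg
  ext x
  exact h x

theorem SemilinearBaseChange.id {φ : R →+* R} (hφ : φ = RingHom.id R) (g : M →ₛₗ[φ] M)
    (hg : ∀ x, g x = x) : SemilinearBaseChange φ g := by
  subst hφ
  exact (IsBaseChange.ofEquiv (LinearEquiv.refl R M)).semilinear rfl _ hg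

/-- Transitivity of base change, needed for the passage from sections to stalks to fibres. -/
theorem SemilinearBaseChange.comp {R'' P : Type*} [CommRing R''] [AddCommGroup P] [Module R'' P]
    {ψ : R →+* R'} {ψ' : R' →+* R''} {ψ'' : R →+* R''} (hψ : ψ'.comp ψ = ψ'')
    {g : M →ₛₗ[ψ] N} {g' : N →ₛₗ[ψ'] P} (hg : SemilinearBaseChange ψ g)
    (hg' : SemilinearBaseChange ψ' g') (g'' : M →ₛₗ[ψ''] P) (h : ∀ x, g'' x = g' (g x)) :
    SemilinearBaseChange ψ'' g'' := by
  subst hψ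
  let := ψ.toAlgebra
  let := ψ'.toAlgebra
  let := (ψ'.comp ψ).toAlgebra
  let : Module R N := Module.compHom N ψ
  let : Module R' P := Module.compHom P ψ'
  let : Module R P := Module.compHom P (ψ'.comp ψ)
  have : IsScalarTower R R' N := ⟨fun r s x => mul_smul (ψ r) s x⟩
  have : IsScalarTower R' R'' P := ⟨fun r s x => mul_smul (ψ' r) s x⟩
  have : IsScalarTower R R'' P := ⟨fun r s x => mul_smul (ψ' (ψ r)) s x⟩
  have : IsScalarTower R R' P :=
    ⟨fun r s x => (congrArg (· • x) (map_mul ψ' (ψ r) s)).trans (mul_smul (ψ' (ψ r)) (ψ' s) x)⟩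
  have : IsScalarTower R R' R'' := IsScalarTower.of_algebraMap_eq fun _ => rfl
  exact (IsBaseChange.comp hg hg').semilinear rfl g'' h

end SemilinearBaseChange

/-! ### Recognizing base changes, and the case of the base field -/

namespace GrMod

variable {K A R : Type u} [Field K] [CommRing A] [Algebra K A] [CommRing R]
  {𝓐 : ℕ → Submodule K A} [GradedAlgebra 𝓐] {φ : K →+* R}

theorem nonempty_iso_of_bijective {M N : GrMod 𝓐 φ} (f : M ⟶ N)
    (hf : ∀ j, Function.Bijective (f.app j)) : Nonempty (M ≅ N) := by
  have := (mono_iff f).mpr fun j => (hf j).1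
  have := (epi_iff f).mpr fun j => (hf j).2
  have := isIso_of_mono_of_epi f
  exact ⟨asIso f⟩

theorem semilinearBaseChange_toBaseChange {R' : Type u} [CommRing R'] (M : GrMod 𝓐 φ)
    (ψ : R →+* R') (j : ℤ) : SemilinearBaseChange ψ
      ({ toFun := toBaseChange M ψ j, map_add' := map_add _,
         map_smul' := toBaseChange_smul M ψ j } : M.X j →ₛₗ[ψ] (M.baseChange ψ).X j) := by
  let := ψ.toAlgebra
  exact (TensorProduct.isBaseChange R (M.X j) R').semilinear rfl _ fun _ => rfl

/-- A graded module is a base change if its components are. -/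
theorem nonempty_iso_baseChange {R' : Type u} [CommRing R'] {M : GrMod 𝓐 φ} {ψ : R →+* R'}
    {φ' : K →+* R'} (h : ψ.comp φ = φ') {M' : GrMod 𝓐 φ'} (g : ∀ j, M.X j →ₛₗ[ψ] M'.X j)
    (hact : ∀ (i : ℕ) {j k : ℤ} (h : (i : ℤ) + j = k) (a : 𝓐 i) (x : M.X j),
      g k (M.act i h a x) = M'.act i h a (g j x))
    (hg : ∀ j, SemilinearBaseChange ψ (g j)) :
    Nonempty (M' ≅ (M.baseChange ψ).congrScalars h) := by
  subst h
  let g' : M ⟶ restrictScalars ψ M' := Hom.mk (fun j =>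
    letI := Module.compHom (M'.X j) ψ
    { toFun := g j, map_add' := (g j).map_add, map_smul' := (g j).map_smulₛₗ }) hact
  obtain ⟨e⟩ := nonempty_iso_of_bijective (baseChangeLift g') fun j => hg j
  exact ⟨e.symm⟩

/-- The truncation maps on `Ext` are bijective in large degrees. -/
theorem FinGen.exists_extTrunc_bijective_field [Algebra.FiniteType K A]
    {M : GrMod 𝓐 (RingHom.id K)} (hM : M.FinGen) (N : GrMod 𝓐 (RingHom.id K)) (i : ℕ) :
    ∃ q₀ : ℤ, ∀ q ≥ q₀, Function.Bijective (extTrunc M N i q) := by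
  -- The base is the field `K`, which is noetherian with all modules flat, and M is its own base
  -- change along the identity.
  obtain ⟨q₀, h⟩ := hM.exists_extTrunc_bijective i
  refine ⟨q₀, h K (RingHom.id K) (RingHom.id K) (RingHom.id_comp _) M N ?_⟩
  exact nonempty_iso_baseChange _ (fun j => LinearMap.id) (fun _ _ _ _ _ _ => rfl)
    fun j => SemilinearBaseChange.id rfl _ fun _ => rfl

end GrMod

/-! ### Vector bundles are quasi-coherent -/

section Quasicoherent

/-- The free sheaf of modules is presented by its basis, without relations. -/
noncomputable def SheafOfModules.presentationFree {S : Scheme.{u}} (I : Type u) :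
    (SheafOfModules.free (R := S.ringCatSheaf) I).Presentation where
  generators := SheafOfModules.free.generatingSections I
  relations :=
    { I := ULift Empty
      s := fun j => Empty.rec _ j.down
      -- The map from the generators is a monomorphism, so its kernel is zero and the empty family
      -- generates it.
      epi := IsZero.epi (IsZero.of_iso (isZero_zero _) (Limits.kernel.ofMono _)) _ }

/-- A presentation of a sheaf of modules over an open subset on which it is free. -/
noncomputable def presentationOver {S : Scheme.{u}} (F : S.Modules) (U : S.Opens) (I : Type u)
    (e : F.restrict U.ι ≅ (SheafOfModules.free (R := (U : Scheme.{u}).ringCatSheaf) I :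
        (U : Scheme.{u}).Modules)) :
    SheafOfModules.Presentation (SheafOfModules.over F U) :=
  have : PreservesColimitsOfSize.{u, u} (Scheme.Modules.overEquiv U).inverse :=
    (Scheme.Modules.overEquiv U).symm.toAdjunction.leftAdjoint_preservesColimits
  let i : (Scheme.Modules.overEquiv U).inverse.obj
      (SheafOfModules.free (R := (U : Scheme.{u}).ringCatSheaf) I) ≅ SheafOfModules.over F U :=
    (Scheme.Modules.overEquiv U).inverse.mapIso
      (e.symm ≪≫ ((Scheme.Modules.overFunctorEquiv U).app F).symm) ≪≫
      ((Scheme.Modules.overEquiv U).unitIso.app _).symm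
  SheafOfModules.Presentation.ofIsIso i.hom
    (@SheafOfModules.Presentation.map _ _ _ _ _ _ _ _ _ _ _ _ _ (SheafOfModules.presentationFree I)
      (Scheme.Modules.overEquiv U).inverse this
      ((Scheme.Modules.overEquiv U).unitIso.app (SheafOfModules.unit _)))

theorem IsVectorBundle.isQuasicoherent {S : Scheme.{u}} {F : S.Modules} (hF : IsVectorBundle F) :
    F.IsQuasicoherent := by
  choose U hU n e using hF
  exact SheafOfModules.QuasicoherentData.isQuasicoherent.{u} (M := F)
    { I := S
      X := U
      coversTop := (Opens.coversTop_iff _ U).mpr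
        (TopologicalSpace.Opens.ext (Set.eq_univ_of_forall fun s =>
          TopologicalSpace.Opens.mem_iSup.mpr ⟨s, hU s⟩))
      presentation := fun s => presentationOver F (U s) _ (e s).some }

end Quasicoherent

/-! ### Sections of quasi-coherent modules over affine opens -/

section AffineSections

/-- A scalar `r` acts on Spec Γ(X, U) as a global section and on X through restriction. Identifying
the two translates the localization property on the spectrum into statements about sections on X. -/
theorem IsAffineOpen.fromSpec_appIso_inv {X : Scheme.{u}} {U : X.Opens} (hU : IsAffineOpen U)
    (W : (Spec Γ(X, U)).Opens) (h : hU.fromSpec ''ᵁ W ≤ U) (r : Γ(X, U)) :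
    (hU.fromSpec.appIso W).inv ((Spec Γ(X, U)).presheaf.map W.leTop.op
      ((Scheme.ΓSpecIso Γ(X, U)).inv r)) = X.presheaf.map (homOfLE h).op r := by
  have : X.presheaf.map (homOfLE h).op ≫ (hU.fromSpec.appIso W).hom =
      (Scheme.ΓSpecIso Γ(X, U)).inv ≫ (Spec Γ(X, U)).presheaf.map W.leTop.op := by
    rw [Scheme.Hom.appIso_hom, hU.fromSpec.naturality_assoc, hU.fromSpec_app_self, Category.assoc,
      ← Functor.map_comp, ← Functor.map_comp]
    rfl
  rw [← Iso.eq_comp_inv] at this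
  rw [this]
  rfl

theorem smul_restrict_fromSpec {X : Scheme.{u}} {U : X.Opens} (hU : IsAffineOpen U)
    (F : X.Modules) (W : (Spec Γ(X, U)).Opens) (h : hU.fromSpec ''ᵁ W ≤ U) (r : Γ(X, U))
    (x : Γ(F.restrict hU.fromSpec, W)) :
    r • x = ((X.presheaf.map (homOfLE h).op r • (show Γ(F, hU.fromSpec ''ᵁ W) from x) :) :
      Γ(F, hU.fromSpec ''ᵁ W)) :=
  congrArg (fun c : Γ(X, hU.fromSpec ''ᵁ W) => c • (show Γ(F, hU.fromSpec ''ᵁ W) from x))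
    (IsAffineOpen.fromSpec_appIso_inv hU W h r)

variable {X : Scheme.{u}} (F : X.Modules) [F.IsQuasicoherent] {U : X.Opens}

theorem isLocalizing_restrict_fromSpec (hU : IsAffineOpen U) :
    IsLocalizing (modulesSpecToSheaf.obj (F.restrict hU.fromSpec)) :=
  have : (F.restrict hU.fromSpec).IsQuasicoherent :=
    Scheme.Modules.isQuasicoherent_restrictFunctor hU.fromSpec F
  (isIso_fromTildeΓ_iff_isLocalizing _).mp inferInstance

/-- Sections over a basic open subset extend after multiplication by a power. -/
theorem exists_map_eq_pow_smul (hU : IsAffineOpen U) (f : Γ(X, U)) (s : Γ(F, X.basicOpen f)) :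
    ∃ (n : ℕ) (t : Γ(F, U)), F.presheaf.map (homOfLE (X.basicOpen_le f)).op t =
      X.presheaf.map (homOfLE (X.basicOpen_le f)).op (f ^ n) • s := by
  -- The images of ⊤ and of the basic open under `fromSpec` are `U` and `X.basicOpen f` only
  -- propositionally; with variables V and D the equalities can be substituted.
  have key : ∀ (V D : X.Opens) (hV : hU.fromSpec ''ᵁ ⊤ = V)
      (hD : hU.fromSpec ''ᵁ (PrimeSpectrum.basicOpen f) = D) (hDV : D ≤ V) (hDU : D ≤ U)
      (s : Γ(F, D)), ∃ (n : ℕ) (t : Γ(F, V)), F.presheaf.map (homOfLE hDV).op t =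
        X.presheaf.map (homOfLE hDU).op (f ^ n) • s := by
    rintro _ _ rfl rfl hDV hDU s
    have := isLocalizing_restrict_fromSpec F hU f
    obtain ⟨⟨y, _, n, rfl⟩, hy⟩ := this.surj s
    exact ⟨n, y, hy.symm.trans (smul_restrict_fromSpec hU F _ hDU (f ^ n) s)⟩
  refine key U (X.basicOpen f) ?_ (hU.fromSpec_image_basicOpen f) _ _ s
  rw [Scheme.Hom.image_top_eq_opensRange, hU.opensRange_fromSpec]

/-- Sections which vanish on a basic open subset are killed by a power. -/
theorem exists_pow_smul_eq_zero (hU : IsAffineOpen U) (f : Γ(X, U)) (t : Γ(F, U))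
    (ht : F.presheaf.map (homOfLE (X.basicOpen_le f)).op t = 0) : ∃ n : ℕ, f ^ n • t = 0 := by
  have key : ∀ (V D : X.Opens) (hV : hU.fromSpec ''ᵁ ⊤ = V)
      (hD : hU.fromSpec ''ᵁ (PrimeSpectrum.basicOpen f) = D) (hDV : D ≤ V) (hVU : V ≤ U)
      (t : Γ(F, V)), F.presheaf.map (homOfLE hDV).op t = 0 →
        ∃ n : ℕ, X.presheaf.map (homOfLE hVU).op (f ^ n) • t = 0 := by
    rintro _ _ rfl rfl hDV hVU t ht
    have := isLocalizing_restrict_fromSpec F hU f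
    obtain ⟨⟨_, n, rfl⟩, hn⟩ := (IsLocalizedModule.eq_zero_iff (.powers f)
      ((modulesSpecToSheaf.obj (F.restrict hU.fromSpec)).obj.map
        (PrimeSpectrum.basicOpen f).leTop.op).hom).mp ht
    exact ⟨n, (smul_restrict_fromSpec hU F _ hVU (f ^ n) t).symm.trans hn⟩
  obtain ⟨n, hn⟩ := key U (X.basicOpen f)
    (by rw [Scheme.Hom.image_top_eq_opensRange, hU.opensRange_fromSpec])
    (hU.fromSpec_image_basicOpen f) (X.basicOpen_le f) le_rfl t ht
  refine ⟨n, ?_⟩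
  rwa [show (homOfLE (le_refl U)).op = 𝟙 (Opposite.op U) from rfl, X.presheaf.map_id] at hn

end AffineSections

/-! ### Stalks as localizations, and flatness -/

section Stalks

open GrSheaf

variable {X : Scheme.{u}} (F : X.Modules) {U : X.Opens} {s : X}

/-- Taking the germ of a section, as a semilinear map. -/
noncomputable def germSemilinear (hs : s ∈ U) :
    Γ(F, U) →ₛₗ[(X.presheaf.germ U s hs).hom] F.presheaf.stalk s where
  toFun := F.presheaf.germ U s hs
  map_add' := map_add _
  map_smul' := germ_smul F s U hs

/-- The stalk of a quasi-coherent module is a localization of the module of sections over an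
affine open neighbourhood. -/
theorem isLocalizedModule_germ [F.IsQuasicoherent] (hU : IsAffineOpen U) (hs : s ∈ U)
    (P : Ideal Γ(X, U)) [P.IsPrime]
    (hP : letI := TopCat.Presheaf.algebra_section_stalk X.presheaf (⟨s, hs⟩ : U)
      IsLocalization.AtPrime (X.presheaf.stalk s) P) :
    letI := Module.compHom (F.presheaf.stalk s) (X.presheaf.germ U s hs).hom
    IsLocalizedModule P.primeCompl
      ({ toFun := germSemilinear F hs, map_add' := (germSemilinear F hs).map_add,
         map_smul' := (germSemilinear F hs).map_smulₛₗ } :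
        Γ(F, U) →ₗ[Γ(X, U)] F.presheaf.stalk s) := by
  let := TopCat.Presheaf.algebra_section_stalk X.presheaf (⟨s, hs⟩ : U)
  let := Module.compHom (F.presheaf.stalk s) (X.presheaf.germ U s hs).hom
  have hmem (f : Γ(X, U)) : s ∈ X.basicOpen f ↔ f ∈ P.primeCompl :=
    (X.mem_basicOpen f s hs).trans
      (IsLocalization.AtPrime.isUnit_to_map_iff (X.presheaf.stalk s) P f)
  -- Elements outside P are units in the stalk; every germ at s lives on a basic open of some f and
  -- extends to U after multiplication by a power of f; a section with zero germ vanishes on such a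
  -- basic open and is killed by a power of f.
  refine ⟨fun f => ?_, fun y => ?_, fun {x₁ x₂} h => ?_⟩
  · have hf : IsUnit (X.presheaf.germ U s hs f.1) :=
      (X.mem_basicOpen f.1 s hs).mp ((hmem f.1).mpr f.2)
    rw [Module.End.isUnit_iff]
    exact MulAction.bijective (β := F.presheaf.stalk s) hf.unit
  · obtain ⟨V, hVU, hV, y, rfl⟩ := exists_germ_le F s U hs y
    obtain ⟨f, hfV, hf⟩ := hU.exists_basicOpen_le ⟨s, hV⟩ hs
    obtain ⟨n, t, ht⟩ := exists_map_eq_pow_smul F hU f (F.presheaf.map (homOfLE hfV).op y)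
    have hfn : f ^ n ∈ P.primeCompl := pow_mem ((hmem f).mp hf) n
    refine ⟨(t, ⟨f ^ n, hfn⟩), ?_⟩
    have := congrArg (F.presheaf.germ (X.basicOpen f) s hf) ht
    rw [TopCat.Presheaf.germ_res_apply F.presheaf _ s hf, germ_smul,
      TopCat.Presheaf.germ_res_apply X.presheaf _ s hf,
      TopCat.Presheaf.germ_res_apply F.presheaf _ s hf] at this
    exact this.symm
  · have h0 : F.presheaf.germ U s hs (x₁ - x₂) = F.presheaf.germ U s hs 0 := by
      rw [map_sub, map_zero, sub_eq_zero]
      exact h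
    obtain ⟨W, hW, iU, iU', hx⟩ := TopCat.Presheaf.germ_eq F.presheaf s hs hs _ _ h0
    obtain ⟨f, hfW, hf⟩ := hU.exists_basicOpen_le ⟨s, hW⟩ hs
    have hres : F.presheaf.map (homOfLE (X.basicOpen_le f)).op (x₁ - x₂) = 0 := by
      have := congrArg (F.presheaf.map (homOfLE hfW).op) hx
      rw [map_zero, map_zero, ← ConcreteCategory.comp_apply, ← Functor.map_comp] at this
      exact this
    obtain ⟨n, hn⟩ := exists_pow_smul_eq_zero F hU f _ hres
    refine ⟨⟨f ^ n, pow_mem ((hmem f).mp hf) n⟩, ?_⟩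
    rw [smul_sub, sub_eq_zero] at hn
    exact hn

/-- The stalk of a quasi-coherent module is a base change of the module of sections over an
affine open neighbourhood. -/
theorem semilinearBaseChange_germ [F.IsQuasicoherent] (hU : IsAffineOpen U) (hs : s ∈ U) :
    SemilinearBaseChange (X.presheaf.germ U s hs).hom (germSemilinear F hs) := by
  let := TopCat.Presheaf.algebra_section_stalk X.presheaf (⟨s, hs⟩ : U)
  let := Module.compHom (F.presheaf.stalk s) (X.presheaf.germ U s hs).hom
  have : IsScalarTower Γ(X, U) (X.presheaf.stalk s) (F.presheaf.stalk s) :=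
    ⟨fun r t x => mul_smul (X.presheaf.germ U s hs r) t x⟩
  have := hU.isLocalization_stalk ⟨s, hs⟩
  have := isLocalizedModule_germ F hU hs (hU.primeIdealOf ⟨s, hs⟩).asIdeal this
  exact (IsLocalizedModule.isBaseChange (hU.primeIdealOf ⟨s, hs⟩).asIdeal.primeCompl
    (X.presheaf.stalk s)
    ({ toFun := germSemilinear F hs, map_add' := (germSemilinear F hs).map_add,
       map_smul' := (germSemilinear F hs).map_smulₛₗ } :
      Γ(F, U) →ₗ[Γ(X, U)] F.presheaf.stalk s)).semilinear rfl _ fun _ => rfl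

/-- Flatness is preserved by base change, and the stalk is one. -/
theorem flat_stalk [F.IsQuasicoherent] (hU : IsAffineOpen U) (hs : s ∈ U)
    [Module.Flat Γ(X, U) Γ(F, U)] : Module.Flat (X.presheaf.stalk s) (F.presheaf.stalk s) := by
  let := (X.presheaf.germ U s hs).hom.toAlgebra
  let := Module.compHom (F.presheaf.stalk s) (X.presheaf.germ U s hs).hom
  have : IsScalarTower Γ(X, U) (X.presheaf.stalk s) (F.presheaf.stalk s) :=
    ⟨fun r t x => mul_smul (X.presheaf.germ U s hs r) t x⟩
  exact Module.Flat.isBaseChange Γ(X, U) (X.presheaf.stalk s) Γ(F, U) (F.presheaf.stalk s)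
    (semilinearBaseChange_germ F hU hs)

/-- Flatness of a quasi-coherent module can be checked on stalks. -/
theorem flat_sections [F.IsQuasicoherent] (hU : IsAffineOpen U)
    (h : ∀ s ∈ U, Module.Flat (X.presheaf.stalk s) (F.presheaf.stalk s)) :
    Module.Flat Γ(X, U) Γ(F, U) := by
  have hmem (P : PrimeSpectrum Γ(X, U)) : hU.fromSpec P ∈ U := by
    rw [← SetLike.mem_coe, ← hU.range_fromSpec]
    exact ⟨P, rfl⟩
  -- The localization at a maximal ideal P is realized as the stalk at the point of U that
  -- corresponds to P.
  let m (P : Ideal Γ(X, U)) [hP : P.IsMaximal] : Module Γ(X, U)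
      (F.presheaf.stalk (hU.fromSpec ⟨P, hP.isPrime⟩)) :=
    Module.compHom _ (X.presheaf.germ U _ (hmem ⟨P, hP.isPrime⟩)).hom
  refine @Module.flat_of_isLocalized_maximal Γ(X, U) Γ(X, U) _ _ _ Γ(F, U) _ _ _ _
    (fun P hP => F.presheaf.stalk (hU.fromSpec ⟨P, hP.isPrime⟩)) (fun _ _ => inferInstance)
    m m (fun P hP => ⟨fun r r' x => ?_⟩)
    (fun P hP => { toFun := germSemilinear F (hmem ⟨P, hP.isPrime⟩)
                   map_add' := (germSemilinear F (hmem ⟨P, hP.isPrime⟩)).map_add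
                   map_smul' := (germSemilinear F (hmem ⟨P, hP.isPrime⟩)).map_smulₛₗ })
    (fun P hP => isLocalizedModule_germ F hU (hmem ⟨P, hP.isPrime⟩) P
      (hU.isLocalization_stalk' ⟨P, hP.isPrime⟩ (hmem ⟨P, hP.isPrime⟩)))
    fun P hP => ?_
  · exact (m P).mul_smul r r' x
  · let := TopCat.Presheaf.algebra_section_stalk X.presheaf (⟨_, hmem ⟨P, hP.isPrime⟩⟩ : U)
    let := m P
    have : IsScalarTower Γ(X, U) (X.presheaf.stalk (hU.fromSpec ⟨P, hP.isPrime⟩))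
        (F.presheaf.stalk (hU.fromSpec ⟨P, hP.isPrime⟩)) :=
      ⟨fun r t x => mul_smul (X.presheaf.germ U _ (hmem ⟨P, hP.isPrime⟩) r) t x⟩
    have := h _ (hmem ⟨P, hP.isPrime⟩)
    have hloc : IsLocalization.AtPrime (X.presheaf.stalk (hU.fromSpec ⟨P, hP.isPrime⟩)) P :=
      hU.isLocalization_stalk' ⟨P, hP.isPrime⟩ (hmem ⟨P, hP.isPrime⟩)
    -- The local ring is flat over Γ(X, U), so flatness over it descends to Γ(X, U) by transitivity.
    have := IsLocalization.flat (X.presheaf.stalk (hU.fromSpec ⟨P, hP.isPrime⟩)) P.primeCompl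
    exact Module.Flat.trans Γ(X, U) (X.presheaf.stalk (hU.fromSpec ⟨P, hP.isPrime⟩)) _

end Stalks

/-! ### Flatness of vector bundles -/

section VectorBundles

theorem Module.Flat.of_smul_eq {R M : Type*} [CommRing R] [AddCommGroup M] {m m' : Module R M}
    (hf : @Module.Flat R M _ _ m) (h : ∀ (r : R) (x : M), m.smul r x = m'.smul r x) :
    @Module.Flat R M _ _ m' :=
  Module.ext' m m' h ▸ hf

/-- Evaluation on W is additive, so it preserves finite coproducts: the sections form a finite sum
of copies of Γ(Y, W), which is projective. -/
theorem flat_sections_of_iso_free {Y : Scheme.{u}} {F : Y.Modules} (I : Type u) [Finite I]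
    (e : F ≅ (SheafOfModules.free (R := Y.ringCatSheaf) I : Y.Modules)) (W : Y.Opens) :
    Module.Flat Γ(Y, W) Γ(F, W) := by
  let ev : SheafOfModules.{u} Y.ringCatSheaf ⥤
      ModuleCat.{u} (Y.ringCatSheaf.obj.obj (Opposite.op W)) :=
    SheafOfModules.evaluation.{u} Y.ringCatSheaf (Opposite.op W)
  have : ev.Additive := { map_add := rfl }
  have : PreservesFiniteCoproducts ev := inferInstance
  have : Projective (ev.obj (SheafOfModules.unit.{u} Y.ringCatSheaf)) :=
    (IsProjective.iff_projective _).mp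
      (inferInstanceAs (Module.Projective Γ(Y, W) Γ(Y, W)))
  have : Projective (ev.obj (SheafOfModules.free.{u} (R := Y.ringCatSheaf) I)) :=
    Projective.of_iso (PreservesCoproduct.iso ev
      (fun _ : I => SheafOfModules.unit.{u} Y.ringCatSheaf)).symm inferInstance
  have : Projective (ev.obj F) := Projective.of_iso (ev.mapIso e.symm) this
  have hP := (IsProjective.iff_projective (R := Y.ringCatSheaf.obj.obj (Opposite.op W))
    (ev.obj F)).mpr this
  have : Module.Projective Γ(Y, W) Γ(F, W) := hP
  infer_instance

theorem IsVectorBundle.flat_stalk {S : Scheme.{u}} {F : S.Modules} (hF : IsVectorBundle F)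
    (s : S) : Module.Flat (S.presheaf.stalk s) (F.presheaf.stalk s) := by
  have := hF.isQuasicoherent
  obtain ⟨U, hs, n, ⟨e⟩⟩ := hF s
  obtain ⟨W, hW, hsW, -⟩ := (U : Scheme.{u}).isBasis_affineOpens.exists_subset_of_mem_open
    (Set.mem_univ (⟨s, hs⟩ : U)) isOpen_univ
  obtain ⟨W, hW', rfl⟩ := hW
  have := flat_sections_of_iso_free _ e W
  have : Module.Flat Γ(S, U.ι ''ᵁ W) Γ(F, U.ι ''ᵁ W) := by
    -- The restricted module has the same sections, with scalars acting through `U.ι.appIso`, which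
    -- is the identity.
    refine Module.Flat.of_smul_eq (R := Γ(S, U.ι ''ᵁ W)) (M := Γ(F, U.ι ''ᵁ W)) this fun r x => ?_
    change (show Γ(F, U.ι ''ᵁ W) from ((U.ι.appIso W).inv r • (show Γ(F, U.ι ''ᵁ W) from x))) = _
    rw [Scheme.Opens.ι_appIso]
    rfl
  exact _root_.flat_stalk F (IsAffineOpen.image_of_isOpenImmersion hW' U.ι)
    ⟨⟨s, hs⟩, hsW, rfl⟩

/-- U need not lie in a trivializing open, hence the detour through stalks. -/
theorem IsVectorBundle.flat_sections {S : Scheme.{u}} {F : S.Modules} (hF : IsVectorBundle F)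
    {U : S.Opens} (hU : IsAffineOpen U) : Module.Flat Γ(S, U) Γ(F, U) :=
  have := hF.isQuasicoherent
  _root_.flat_sections F hU fun s _ => hF.flat_stalk s

end VectorBundles

/-! ### Families over a noetherian scheme, and the theorem -/

section Families

variable {K A : Type u} [Field K] [CommRing A] [Algebra K A]
  {𝓐 : ℕ → Submodule K A} [GradedAlgebra 𝓐] {S : Scheme.{u}} {f : S ⟶ Spec (CommRingCat.of K)}

theorem germ_comp_sectionScalars (f : S ⟶ Spec (CommRingCat.of K)) (U : S.Opens) (s : S)
    (hs : s ∈ U) :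
    (S.presheaf.germ U s hs).hom.comp (sectionScalars f U) = stalkScalars f s := by
  ext c
  change _ = S.presheaf.germ ⊤ s trivial (sectionScalars f ⊤ c)
  rw [← TopCat.Presheaf.germ_res_apply S.presheaf (homOfLE le_top : U ⟶ ⊤) s hs]
  simp [sectionScalars]

namespace GrSheaf

theorem residue_comp_germ_comp_sectionScalars (f : S ⟶ Spec (CommRingCat.of K)) (U : S.Opens)
    (s : S) (hs : s ∈ U) :
    ((S.residue s).hom.comp (S.presheaf.germ U s hs).hom).comp (sectionScalars f U) =
      residueScalars f s := by
  rw [RingHom.comp_assoc, germ_comp_sectionScalars]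

/-- The fibres of a family are base changes of the sections over an affine open subset. -/
theorem IsFamily.nonempty_fiber_iso {M : GrSheaf 𝓐 f} (hM : M.IsFamily) {U : S.Opens}
    (hU : IsAffineOpen U) (s : S) (hs : s ∈ U) :
    Nonempty (M.fiber s ≅ ((M.sections U).baseChange
      ((S.residue s).hom.comp (S.presheaf.germ U s hs).hom)).congrScalars
        (residue_comp_germ_comp_sectionScalars f U s hs)) := by
  refine GrMod.nonempty_iso_baseChange _ (M := M.sections U) (M' := M.fiber s) (fun j =>
    { toFun := fun x => GrMod.toBaseChange (M.stalk s) (S.residue s).hom j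
        (germSemilinear (M.comp j) hs x)
      map_add' := fun x y => (congrArg _ ((germSemilinear (M.comp j) hs).map_add x y)).trans
        (map_add (GrMod.toBaseChange (M.stalk s) (S.residue s).hom j) _ _)
      map_smul' := fun r x => (congrArg _ ((germSemilinear (M.comp j) hs).map_smulₛₗ r x)).trans
        (GrMod.toBaseChange_smul (M.stalk s) (S.residue s).hom j _ _) })
    (fun i j k h a x => ?_) fun j => ?_
  · exact congrArg (GrMod.toBaseChange (M.stalk s) (S.residue s).hom k)
      (stalkMap_germ (M.act i h a) s U hs x).symm
  · have := (hM.vectorBundle j).isQuasicoherent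
    -- The map x ↦ 1 ⊗ germ x is the composite of the base changes to the local ring and to the
    -- residue field.
    exact (semilinearBaseChange_germ (M.comp j) hU hs).comp rfl
      (GrMod.semilinearBaseChange_toBaseChange (M.stalk s) (S.residue s).hom j) _ fun _ => rfl

/-- The truncation maps on `Ext` between the fibres of families over a noetherian scheme are
bijective in large degrees, uniformly. -/
theorem IsFamily.exists_extTrunc_bijective [Algebra.FiniteType K A] [IsNoetherian S]
    {M : GrSheaf 𝓐 f} (hM : M.IsFamily) (N : GrSheaf 𝓐 f) (i : ℕ) :
    ∃ q₀ : ℤ, ∀ q ≥ q₀, ∀ s : S,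
      Function.Bijective (GrMod.extTrunc (M.fiber s) (N.fiber s) i q) := by
  choose U hU hsU hfin using hM.finiteType
  have key (s : S) : ∃ q₀ : ℤ, ∀ q ≥ q₀, ∀ t ∈ U s,
      Function.Bijective (GrMod.extTrunc (M.fiber t) (N.fiber t) i q) := by
    have : IsNoetherianRing Γ(S, U s) := IsLocallyNoetherian.component_noetherian ⟨U s, hU s⟩
    have (j : ℤ) : Module.Flat Γ(S, U s) ((M.sections (U s)).X j) :=
      (hM.vectorBundle j).flat_sections (hU s)
    obtain ⟨q₀, h⟩ := (hfin s).exists_extTrunc_bijective i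
    exact ⟨q₀, fun q hq t ht => h _ _ _ _ _ _ (hM.nonempty_fiber_iso (hU s) t ht) q hq⟩
  choose q hq using key
  -- Each U s has its own bound; by quasi-compactness finitely many of them cover S, and their
  -- bounds have a common upper bound.
  obtain ⟨T, hT⟩ := CompactSpace.elim_nhds_subcover (fun s => (U s : Set S))
    fun s => (U s).isOpen.mem_nhds (hsU s)
  obtain ⟨q₀, hq₀⟩ := (T.image q).bddAbove
  refine ⟨q₀, fun r hr s => ?_⟩
  obtain ⟨t, ht, hs⟩ := Set.mem_iUnion₂.mp (hT.ge (Set.mem_univ s))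
  exact hq t r ((hq₀ (by simpa using ⟨t, ht, rfl⟩)).trans hr) s hs

end GrSheaf

attribute [local instance] MvPolynomial.gradedAlgebra

/-- S is quasi-compact and locally of finite type over the spectrum of the degree 0 part of the
polynomial ring, which is a quotient of `K` since homogeneous polynomials of degree 0 are constants.
-/
theorem IsProjectiveScheme.isNoetherian (hf : IsProjectiveScheme f) : IsNoetherian S := by
  obtain ⟨n, ι, hι, rfl⟩ := hf
  let 𝒜 := MvPolynomial.homogeneousSubmodule (Fin (n + 1)) K
  have hs : Function.Surjective (algebraMap K (𝒜 0)) := by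
    rintro ⟨p, hp⟩
    exact ⟨_, Subtype.ext ((MvPolynomial.totalDegree_eq_zero_iff_eq_C).mp
      (Nat.le_zero.mp ((MvPolynomial.IsHomogeneous.totalDegree_le hp)))).symm⟩
  have : IsNoetherianRing (𝒜 0) := isNoetherianRing_of_surjective _ _ _ hs
  have : IsScalarTower K (𝒜 0) (MvPolynomial (Fin (n + 1)) K) :=
    ⟨fun r x y => smul_mul_assoc r x.1 y⟩
  have : Algebra.FiniteType (𝒜 0) (MvPolynomial (Fin (n + 1)) K) :=
    Algebra.FiniteType.of_restrictScalars_finiteType K _ _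
  have : LocallyOfFiniteType (Proj.toSpecZero 𝒜) := inferInstance
  have : QuasiCompact (Proj.toSpecZero 𝒜) := inferInstance
  let g := ι ≫ Proj.toSpecZero 𝒜
  have : LocallyOfFiniteType g := inferInstance
  have : QuasiCompact g := inferInstance
  have : IsLocallyNoetherian S := LocallyOfFiniteType.isLocallyNoetherian g
  have : CompactSpace S := QuasiCompact.compactSpace_of_compactSpace g
  exact {}

end Families

theorem proposition4p3p4 {K A : Type u} [Field K] [CommRing A] [Algebra K A]
    (𝓐 : ℕ → Submodule K A) [GradedAlgebra 𝓐] [Algebra.FiniteType K A] (i : ℕ) :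
    (∀ M N : GrMod 𝓐 (RingHom.id K), M.FinGen → N.FinGen →
      ∃ q₀ : ℤ, ∀ q ≥ q₀, Function.Bijective (GrMod.extTrunc M N i q)) ∧
    (∀ (S : Scheme.{u}) (f : S ⟶ Spec (CommRingCat.of K)), IsProjectiveScheme f →
      ∀ M N : GrSheaf 𝓐 f, M.IsFamily → N.IsFamily →
        ∃ q₀ : ℤ, ∀ q ≥ q₀, ∀ s : S,
          Function.Bijective (GrMod.extTrunc (M.fiber s) (N.fiber s) i q)) := by
  refine ⟨fun M N hM _ => hM.exists_extTrunc_bijective_field N i, fun S f hf M N hM _ => ?_⟩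
  have := hf.isNoetherian
  exact hM.exists_extTrunc_bijective N i
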